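/- Let $T>0$ and $\tfrac12<\alpha<1$, and let $(\Omega,\mathcal F,\mathbb P)$ be a probability space with a filtration $\mathbb F=\{\mathcal F_t\}_{t\in[0,T]}$. **The process $X$.** Let $X=(X_t)_{t\in[0,T]}$ be an $\mathbb F$-adapted centered Gaussian process with almost surely continuous paths which belongs to the class $\mathcal X^\alpha_T$: there is $\delta\in(0,T]$ such that for every $u\in[T-\delta,T)$ the process $Y_t=X_{t+u}-X_u$, $t\in[0,T-u]$, satisfies the following (with constants that may depend on $u$): 1. $\mathbb E[Y_sY_t]>0$ for all $s,t\in(0,T-u]$; 2. there is $C>0$ with $\sup_{0\le s\le T-u-t}\mathbb E[(Y_{t+s}-Y_s)^2]\le Ct^{2\alpha}$ for all $t\in[0,T-u]$; 3. there are $c,\hat\delta>0$ with $\mathbb E[Y_s^2]\ge cs^2$ for all $s\in[0,T-u]$ with $s\le\hat\delta$; 4. there is $\hat\delta>0$ with $\displaystyle\sup_{0<t<2\hat\delta,\ t\le T-u}\ \sup_{t/2\le s\le t}\frac{\mathbb E[Y_s^2]}{\mathbb E[Y_tY_s]}<\infty$. Assume also the small ball estimate: there are constants $C,\Delta>0$ and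 $\delta\in(0,T]$ such that for all $s,t\in[T-\delta,T]$ with $0<t-s\le\Delta$ and all $0<\epsilon\le(t-s)^\alpha$, $$\mathbb P\Big(\sup_{s\le v\le t}|X_v-X_s|\le\epsilon\Big)\le\exp\big(-C\,(t-s)\,\epsilon^{-1/\alpha}\big).$$ **The integral.** For $0<\beta<1$ let $W^\beta_2$ be the space of measurable $f:[0,T]\to\mathbb R$ with $$\int_0^T\frac{|f(s)|}{s^\beta}\,ds+\int_0^T\!\int_0^s\frac{|f(u)-f(s)|}{(s-u)^{1+\beta}}\,du\,ds<\infty .$$ For $f\in W^\beta_2$ and $g$ continuous on $[0,T]$, put $$D^\beta f(s)=\frac1{\Gamma(1-\beta)}\Big(\frac{f(s)}{s^\beta}+\beta\int_0^s\frac{f(s)-f(u)}{(s-u)^{\beta+1}}\,du\Big),$$ $$\bar D^{1-\beta} g(s)=\frac{1}{\Gamma(\beta)}\Big(\frac{g(s)-g(T)}{(T-s)^{1-\beta}}+(1-\beta)\int_s^T\frac{g(s)-g(u)}{(u-s)^{2-\beta}}\,du\Big).$$ The generalized Lebesgue–Stieltjes integral with exponent $\beta$ exists if the integral in $\bar D^{1-\beta}g(s)$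 converges absolutely for almost every $s\in(0,T)$ with $D^\beta f(s)\ne0$, and the product $D^\beta f\cdot\bar D^{1-\beta}g$ (understood as $0$ where $D^\beta f=0$) is Lebesgue integrable on $(0,T)$; then $$\int_0^Tf\,dg=-\int_0^TD^\beta f(s)\,\bar D^{1-\beta}g(s)\,ds .$$ **Theorem.** Let $\xi$ be an $\mathcal F_T$-measurable random variable. Suppose that there are $a>1-\alpha$ and an $\mathbb F$-adapted process $Z=(Z_s)_{s\in[0,T]}$ whose paths are almost surely Hölder continuous of order $a$ on $[0,T]$ (with a random constant), such that $Z_T=\xi$ almost surely. Then there are an $\mathbb F$-adapted process $\Psi_T=(\Psi_T(s))_{s\in[0,T]}$ and a number $\beta_0>1-\alpha$ such that almost surely, for every $\beta\in(1-\alpha,\beta_0)$, one has $\Psi_T\in W^\beta_2$, the generalized Lebesgue–Stieltjes integral $\int_0^T\Psi_T(s)\,dX_s$ with exponent $\beta$ exists, and $$\int_0^T\Psi_T(s)\,dX_s=\xi .$$ -/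

import Mathlib

open MeasureTheory ProbabilityTheory Set

noncomputable section

namespace GaussRep

variable {Ω : Type*} [MeasurableSpace Ω]

/-- Covariance `R_X(t,s) = E[X_t X_s]` of a centered process. -/
def cov (μ : Measure Ω) (X : ℝ → Ω → ℝ) (t s : ℝ) : ℝ := ∫ ω, X t ω * X s ω ∂μ

/-- Incremental variance `W_X(t,s) = E[(X_t - X_s)²]`. -/
def incVar (μ : Measure Ω) (X : ℝ → Ω → ℝ) (t s : ℝ) : ℝ := ∫ ω, (X t ω - X s ω) ^ 2 ∂μ

/-- Variance `V_X(t) = E[X_t²]` of a centered process. -/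
def var (μ : Measure Ω) (X : ℝ → Ω → ℝ) (t : ℝ) : ℝ := ∫ ω, X t ω ^ 2 ∂μ

/-- The increment process `Y_t = X_{t+u} - X_u`. -/
def incr (X : ℝ → Ω → ℝ) (u : ℝ) (t : ℝ) (ω : Ω) : ℝ := X (t + u) ω - X u ω

/-- The four conditions on a process `Y` on the time interval `[0,S]`. The bound
`w*_Y(t) ≤ C t^{2α}` for the supremum `w*_Y(t) = sup_{0 ≤ s ≤ S-t} W_Y(t+s,s)` and the finiteness of
the supremum of `R_Y(s,s)/R_Y(t,s)` are written pointwise. -/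
structure LocalConditions (μ : Measure Ω) (Y : ℝ → Ω → ℝ) (α S : ℝ) : Prop where
  cov_pos : ∀ s ∈ Ioc 0 S, ∀ t ∈ Ioc 0 S, 0 < cov μ Y s t
  worst_incVar_le : ∃ C > 0, ∀ t s, 0 ≤ t → 0 ≤ s → s ≤ S - t →
    incVar μ Y (t + s) s ≤ C * t ^ (2 * α)
  var_ge : ∃ c > 0, ∃ η > 0, ∀ s ∈ Icc 0 S, s ≤ η → c * s ^ 2 ≤ var μ Y s
  ratio_bdd : ∃ η > 0, ∃ M : ℝ, ∀ t ∈ Ioc 0 S, t < 2 * η → ∀ s ∈ Icc (t / 2) t,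
    cov μ Y s s / cov μ Y t s ≤ M

/-- The class `𝒳^α_T`: centered continuous Gaussian processes on `[0,T]` (values of `X` at times
outside `[0,T]` play no role) whose increment processes started at any time `u` close to `T` satisfy
the four conditions; the constants in these may depend on `u`. -/
structure ClassX (μ : Measure Ω) (X : ℝ → Ω → ℝ) (α T : ℝ) : Prop where
  gaussian : IsGaussianProcess (fun t : Icc (0 : ℝ) T => X t) μ
  centered : ∀ t ∈ Icc 0 T, ∫ ω, X t ω ∂μ = 0
  continuous : ∀ᵐ ω ∂μ, ContinuousOn (fun t => X t ω) (Icc 0 T)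
  alpha_pos : 0 < α
  alpha_lt_one : α < 1
  increments : ∃ δ ∈ Ioc 0 T, ∀ u ∈ Ico (T - δ) T, LocalConditions μ (incr X u) α (T - u)

/-- The small ball assumption near `T`: for short intervals `[s,t]` near `T`, the probability of
`sup_{s ≤ v ≤ t} |X_v - X_s| ≤ ε` is at most `exp(-C (t-s) ε^{-1/α})` if `ε ≤ (t-s)^α`. -/
def SmallBall (μ : Measure Ω) (X : ℝ → Ω → ℝ) (α T : ℝ) : Prop :=
  ∃ C > 0, ∃ δ ∈ Ioc 0 T, ∃ Δ > 0, ∀ s ∈ Icc (T - δ) T, ∀ t ∈ Icc (T - δ) T,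
    s < t → t - s ≤ Δ → ∀ ε, 0 < ε → ε ≤ (t - s) ^ α →
      μ.real {ω | ∀ v ∈ Icc s t, |X v ω - X s ω| ≤ ε}
        ≤ Real.exp (-C * (t - s) * ε ^ (-(1 / α)))

/-- The norm `‖f‖_{2,β}` on `[0,T]`, with values in `[0,∞]`. -/
def besovNorm (β T : ℝ) (f : ℝ → ℝ) : ENNReal :=
  (∫⁻ s in Ioc 0 T, ENNReal.ofReal (|f s| / s ^ β)) +
    ∫⁻ s in Ioc 0 T, ∫⁻ u in Ioc 0 s, ENNReal.ofReal (|f u - f s| / (s - u) ^ (1 + β))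

/-- The fractional Besov space `W^β_2([0,T])`. -/
def MemBesov (β T : ℝ) (f : ℝ → ℝ) : Prop :=
  Measurable (fun s : Icc (0 : ℝ) T => f s) ∧ besovNorm β T f < ⊤

/-- The Riemann–Liouville derivative `D^β_{0+} f` in Weyl's representation. -/
def fracDerivLeft (β : ℝ) (f : ℝ → ℝ) (s : ℝ) : ℝ :=
  (Real.Gamma (1 - β))⁻¹ * (f s / s ^ β + β * ∫ u in 0..s, (f s - f u) / (s - u) ^ (β + 1))

/-- The Riemann–Liouville derivative `D^β_{t-} g` in Weyl's representation, without its unimodular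
constant factor (a power of `-1` with exponent `±β`). -/
def fracDerivRight (β t : ℝ) (g : ℝ → ℝ) (s : ℝ) : ℝ :=
  (Real.Gamma (1 - β))⁻¹ *
    (g s / (t - s) ^ β + β * ∫ u in s..t, (g s - g u) / (u - s) ^ (β + 1))

/-- The generalized Lebesgue–Stieltjes integral `∫_0^t f dg`, computed with the exponent `β`,
exists and equals `I`.

Here `g` is continuous, so that `g_{t-}(s) = g(s) - g(t)`, and `f ∈ W^β_2([0,t])`. The constant
factor in front of the Lebesgue integral is `(-1)^β (-1)^{1-β} = -1`, which gives the
usual `∫_0^t f dg = ∫_0^t f g' ds` for smooth `f` and `g`. Existence means that the product of the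
two fractional derivatives is integrable, where the integral defining the derivative of `g` has to
converge absolutely at almost every point at which the derivative of `f` is not zero. -/
structure HasGLSIntegral (β : ℝ) (f g : ℝ → ℝ) (t I : ℝ) : Prop where
  beta_mem : β ∈ Ioo (0 : ℝ) 1
  continuousOn : ContinuousOn g (Icc 0 t)
  memBesov : MemBesov β t f
  deriv_exists : ∀ᵐ s ∂(volume.restrict (Ioo 0 t)), fracDerivLeft β f s ≠ 0 →
    IntervalIntegrable (fun u => (g s - g u) / (u - s) ^ ((1 - β) + 1)) volume s t
  integrable : IntegrableOn
    (fun s => fracDerivLeft β f s * fracDerivRight (1 - β) t (fun r => g r - g t) s) (Ioo 0 t)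
  integral_eq :
    -∫ s in Ioo 0 t, fracDerivLeft β f s * fracDerivRight (1 - β) t (fun r => g r - g t) s = I

end GaussRep

end

/-! The integrand is a betting strategy on the grid `T - δ / k`. Stage `n` runs over `2 ^ n ≤ k < 2
^ (n + 1)`; it lasts about `2 ^ (-n)` and has mesh about `4 ^ (-n)`. Let `D` be the increment of `X`
since the stage began and `h = 2 ^ (-nθ)`. Holding `2 D / h ^ 2` until `|D|` first reaches `h` earns
nearly `D ^ 2 / h ^ 2 ≈ 1`, since `∑ 2 D ΔD` equals `D ^ 2` minus the sum of squared increments, and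
that sum is negligible because `α > 1/2`. Multiplying this unit bet by the current error (target `Z`
minus wealth) replaces the error by nearly the increment of `Z` over the stage. So the error is `O(2
^ (-na))` and the wealth tends to `Z_T = ξ`.

The level is reached in all but finitely many stages: for `θ > α` the small ball estimate bounds the
probability of a miss by `exp(-c 2 ^ (n(θ/α - 1)))`, and Borel–Cantelli applies
(`ae_eventually_osc`). Gaussian tails and chaining give Hölder paths of every order `γ < α`
(`ae_exists_holder`), which makes overshoot and squared increments negligible once `1 + 2θ < 4γ`
(`tendsto_stageGain`).

It remains to see that the limiting wealth is the generalized Lebesgue–Stieltjes integral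
(`hasGLSIntegral_stepFun`). The left derivative of the indicator of `(p, q]` is explicit, with `L¹`
norm `O((q - p) ^ (1 - β))`; the right derivative of the path is bounded when `1 - β < γ`; and Abel
inversion evaluates their pairing as an increment of the path. Hence only `∑ |c k| (s (k+1) - s k) ^
(1 - β) < ∞` is needed. The bets are `O(k ^ (θ - a))` and the mesh is `O(k ^ (-2))`, so `2β < 1 + a
- θ` suffices. All constraints on `θ` are compatible precisely because `a > 1 - α` and `α > 1/2`. -/

noncomputable section

namespace GaussRep

open Filter Topology

/-! ### Left fractional derivatives of indicator functions -/

/-- The truncated power `(s - p)_+^{-β}`. -/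
def truncPow (β p s : ℝ) : ℝ := max (s - p) 0 ^ (-β)

/-- `Γ(1-β)` times the left fractional derivative of the indicator function of `(p, q]`. -/
def stepKer (β p q s : ℝ) : ℝ := truncPow β p s - truncPow β q s

/-- The convention `0 ^ r = 0` for `r ≠ 0` kills the singular power at `p` and to its left. -/
lemma truncPow_of_le {β p s : ℝ} (hβ : 0 < β) (h : s ≤ p) : truncPow β p s = 0 := by
  rw [truncPow, max_eq_right (by linarith), Real.zero_rpow (by linarith)]

lemma truncPow_of_lt {β p s : ℝ} (h : p < s) : truncPow β p s = (s - p) ^ (-β) := by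
  rw [truncPow, max_eq_left (by linarith)]

lemma truncPow_nonneg (β p s : ℝ) : 0 ≤ truncPow β p s := by
  unfold truncPow; positivity

lemma measurable_truncPow (β p : ℝ) : Measurable (truncPow β p) := by
  unfold truncPow; fun_prop

lemma measurable_stepKer (β p q : ℝ) : Measurable (stepKer β p q) :=
  (measurable_truncPow β p).sub (measurable_truncPow β q)

lemma intervalIntegrable_sub_rpow {β x y s : ℝ} (hxy : x ≤ y) (hys : y < s) :
    IntervalIntegrable (fun u => (s - u) ^ (-(β + 1))) volume x y := by
  apply ContinuousOn.intervalIntegrable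
  rw [uIcc_of_le hxy]
  refine ContinuousOn.rpow_const (by fun_prop) fun u hu => Or.inl ?_
  linarith [hu.2]

lemma integral_sub_rpow {β x y s : ℝ} (hβ : 0 < β) (hxy : x ≤ y) (hys : y < s) :
    ∫ u in x..y, (s - u) ^ (-(β + 1)) = β⁻¹ * ((s - y) ^ (-β) - (s - x) ^ (-β)) := by
  rw [intervalIntegral.integral_comp_sub_left (fun u => u ^ (-(β + 1))) s, integral_rpow]
  · rw [show -(β + 1) + 1 = -β by ring]
    field_simp
    ring
  · right
    refine ⟨by linarith, ?_⟩
    rw [uIcc_of_le (by linarith)]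
    intro h
    linarith [h.1]

/-- Integrals over `(0, s]` of a signed singular kernel restricted to an interval `(x, y]`. -/
lemma singular_indicator {β x y s σ : ℝ} {φ : ℝ → ℝ} (hβ : 0 < β) (hx : 0 ≤ x) (hxy : x ≤ y)
    (hys : y < s) (hφ : ∀ u ∈ Ioc 0 s, φ u = σ * (Ioc x y).indicator (fun u => (s - u) ^ (-(β + 1))) u) :
    IntegrableOn φ (Ioc 0 s) ∧
      ∫ u in Ioc 0 s, φ u = σ * (β⁻¹ * ((s - y) ^ (-β) - (s - x) ^ (-β))) := by
  have hsub : Ioc x y ⊆ Ioc 0 s := fun u hu => ⟨by linarith [hu.1], by linarith [hu.2]⟩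
  have hi := (intervalIntegrable_iff_integrableOn_Ioc_of_le hxy).1
    (intervalIntegrable_sub_rpow (β := β) hxy hys)
  have hint : IntegrableOn (fun u => σ * (Ioc x y).indicator (fun u => (s - u) ^ (-(β + 1))) u)
      (Ioc 0 s) := by
    apply Integrable.const_mul
    rw [integrable_indicator_iff measurableSet_Ioc]
    exact hi.mono_measure Measure.restrict_le_self
  refine ⟨hint.congr_fun (fun u hu => (hφ u hu).symm) measurableSet_Ioc, ?_⟩
  rw [setIntegral_congr_fun measurableSet_Ioc hφ, integral_const_mul,
    setIntegral_indicator measurableSet_Ioc, inter_eq_self_of_subset_right hsub,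
    ← intervalIntegral.integral_of_le hxy, integral_sub_rpow hβ hxy hys]

/-- The unit step function on `(p, q]`. -/
abbrev unitStep (p q : ℝ) : ℝ → ℝ := (Ioc p q).indicator fun _ => 1

/-- The difference of the two step values is, as a function of `u`, zero for `s ≤ p`, the indicator
of `(0, p]` for `p < s < q`, and minus that of `(p, q]` for `s > q`. Its support thus ends strictly
before `s` and the kernel is never singular on it. The term `s ^ (-β)` in the value cancels against
`f s / s ^ β` in the derivative. -/
lemma unitStep_quotient {β p q s : ℝ} (hβ : 0 < β) (hp : 0 ≤ p) (hpq : p ≤ q) (hs : s ≠ q) :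
    IntegrableOn (fun u => (unitStep p q s - unitStep p q u) / (s - u) ^ (β + 1)) (Ioc 0 s) ∧
    ∫ u in Ioc 0 s, (unitStep p q s - unitStep p q u) / (s - u) ^ (β + 1)
      = β⁻¹ * (stepKer β p q s - unitStep p q s * s ^ (-β)) ∧
    ∫ u in Ioc 0 s, |(unitStep p q s - unitStep p q u) / (s - u) ^ (β + 1)|
      ≤ β⁻¹ * |stepKer β p q s| := by
  have hβi : 0 < β⁻¹ := inv_pos.2 hβ
  have key : ∀ u ∈ Ioc 0 s, 1 / (s - u) ^ (β + 1) = (s - u) ^ (-(β + 1)) := fun u hu => by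
    rw [Real.rpow_neg (by linarith [hu.2]), one_div]
  rcases le_or_gt s p with hsp | hsp
  · have h0 : ∀ u ∈ Ioc 0 s, (unitStep p q s - unitStep p q u) / (s - u) ^ (β + 1) = 0 := by
      intro u hu
      rw [unitStep, indicator_of_notMem (fun h => by linarith [h.1]),
        indicator_of_notMem (fun h => by linarith [h.1, hu.2])]
      simp
    refine ⟨integrableOn_zero.congr_fun (fun u hu => (h0 u hu).symm) measurableSet_Ioc, ?_, ?_⟩
    · rw [setIntegral_congr_fun measurableSet_Ioc h0, stepKer, truncPow_of_le hβ hsp,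
        truncPow_of_le hβ (hsp.trans hpq), unitStep, indicator_of_notMem (fun h => by linarith [h.1])]
      simp
    · rw [setIntegral_congr_fun measurableSet_Ioc (fun u hu => by rw [h0 u hu])]
      simp; positivity
  rcases lt_or_gt_of_ne hs with hsq | hsq
  · have hS : unitStep p q s = 1 := indicator_of_mem (show s ∈ Ioc p q from ⟨hsp, hsq.le⟩) _
    have h1 : ∀ u ∈ Ioc 0 s, (unitStep p q s - unitStep p q u) / (s - u) ^ (β + 1)
        = 1 * (Ioc 0 p).indicator (fun u => (s - u) ^ (-(β + 1))) u := by
      intro u hu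
      rw [hS]
      rcases le_or_gt u p with hup | hup
      · rw [unitStep, indicator_of_notMem (fun h => by linarith [h.1]),
          indicator_of_mem (show u ∈ Ioc 0 p from ⟨hu.1, hup⟩), sub_zero, key u hu, one_mul]
      · rw [unitStep, indicator_of_mem (show u ∈ Ioc p q from ⟨hup, hu.2.trans hsq.le⟩),
          indicator_of_notMem (fun h => by linarith [h.2])]
        simp
    have h2 : ∀ u ∈ Ioc 0 s, |(unitStep p q s - unitStep p q u) / (s - u) ^ (β + 1)|
        = 1 * (Ioc 0 p).indicator (fun u => (s - u) ^ (-(β + 1))) u := by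
      intro u hu
      rw [h1 u hu, abs_of_nonneg]
      rw [one_mul]
      exact indicator_nonneg (fun v hv => Real.rpow_nonneg (by linarith [hv.2]) _) _
    obtain ⟨a1, a2⟩ := singular_indicator hβ le_rfl hp hsp h1
    obtain ⟨b1, b2⟩ := singular_indicator hβ le_rfl hp hsp h2
    have hk : stepKer β p q s = (s - p) ^ (-β) := by
      rw [stepKer, truncPow_of_lt hsp, truncPow_of_le hβ hsq.le, sub_zero]
    refine ⟨a1, ?_, ?_⟩
    · rw [a2, hk, hS]; simp
    · rw [b2, hk, abs_of_nonneg (Real.rpow_nonneg (by linarith) _), one_mul]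
      have : 0 ≤ (s - 0) ^ (-β) := Real.rpow_nonneg (by linarith) _
      gcongr
      linarith
  · have hS : unitStep p q s = 0 := indicator_of_notMem (fun h => by linarith [h.2]) _
    have h1 : ∀ u ∈ Ioc 0 s, (unitStep p q s - unitStep p q u) / (s - u) ^ (β + 1)
        = (-1) * (Ioc p q).indicator (fun u => (s - u) ^ (-(β + 1))) u := by
      intro u hu
      rw [hS]
      by_cases hu' : u ∈ Ioc p q
      · rw [unitStep, indicator_of_mem hu', indicator_of_mem hu', ← key u hu]
        ring
      · rw [unitStep, indicator_of_notMem hu', indicator_of_notMem hu']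
        simp
    have h2 : ∀ u ∈ Ioc 0 s, |(unitStep p q s - unitStep p q u) / (s - u) ^ (β + 1)|
        = 1 * (Ioc p q).indicator (fun u => (s - u) ^ (-(β + 1))) u := by
      intro u hu
      rw [h1 u hu, abs_mul, abs_neg, abs_one, abs_of_nonneg]
      exact indicator_nonneg (fun v hv => Real.rpow_nonneg (by linarith [hv.2]) _) _
    obtain ⟨a1, a2⟩ := singular_indicator hβ hp hpq hsq h1
    obtain ⟨b1, b2⟩ := singular_indicator hβ hp hpq hsq h2
    have hk : stepKer β p q s = (s - p) ^ (-β) - (s - q) ^ (-β) := by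
      rw [stepKer, truncPow_of_lt hsp, truncPow_of_lt hsq]
    refine ⟨a1, ?_, ?_⟩
    · rw [a2, hk, hS]; ring
    · rw [b2, hk, abs_sub_comm, one_mul]
      gcongr
      exact le_abs_self _

lemma integrableOn_truncPow {β p A B : ℝ} (hβ : β < 1) (hβ0 : 0 < β) :
    IntegrableOn (truncPow β p) (Ioc A B) := by
  set m := min A p
  set M := max B p
  have h1 : IntegrableOn (truncPow β p) (Ioc m p) :=
    integrableOn_zero.congr_fun (fun s hs => (truncPow_of_le hβ0 hs.2).symm) measurableSet_Ioc
  have h2 : IntegrableOn (truncPow β p) (Ioc p M) := by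
    have : IntervalIntegrable (fun s => (s - p) ^ (-β)) volume p M := by
      have := (intervalIntegral.intervalIntegrable_rpow' (r := -β) (by linarith)
        (a := 0) (b := M - p)).comp_sub_right p
      simpa using this
    rw [intervalIntegrable_iff_integrableOn_Ioc_of_le (le_max_right _ _)] at this
    exact this.congr_fun (fun s hs => (truncPow_of_lt hs.1).symm) measurableSet_Ioc
  refine (h1.union h2).mono_set fun s hs => ?_
  rcases le_or_gt s p with h | h
  · exact Or.inl ⟨(min_le_left _ _).trans_lt hs.1, h⟩
  · exact Or.inr ⟨h, hs.2.trans (le_max_left _ _)⟩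

lemma integrableOn_stepKer {β p q A B : ℝ} (hβ : β < 1) (hβ0 : 0 < β) :
    IntegrableOn (stepKer β p q) (Ioc A B) :=
  (integrableOn_truncPow hβ hβ0).sub (integrableOn_truncPow hβ hβ0)

lemma integral_truncPow {β p B : ℝ} (hβ : β < 1) (hpB : p ≤ B) :
    ∫ s in Ioc p B, truncPow β p s = (B - p) ^ (1 - β) / (1 - β) := by
  rw [setIntegral_congr_fun measurableSet_Ioc (fun s hs => truncPow_of_lt hs.1),
    ← intervalIntegral.integral_of_le hpB,
    intervalIntegral.integral_comp_sub_right (fun s => s ^ (-β)) p, integral_rpow (by left; linarith),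
    sub_self, show -β + 1 = 1 - β by ring, Real.zero_rpow (by linarith), sub_zero]

/-- The positive part lives on `(p, q]` with mass `(q - p) ^ (1 - β) / (1 - β)`; the negative tail
beyond `q` has at most the same mass. -/
lemma integral_abs_stepKer_le {β p q T : ℝ} (hβ0 : 0 < β) (hβ : β < 1) (hp : 0 ≤ p) (hpq : p ≤ q)
    (hqT : q ≤ T) :
    ∫ s in Ioc 0 T, |stepKer β p q s| ≤ 2 / (1 - β) * (q - p) ^ (1 - β) := by
  have hb : 0 < 1 - β := by linarith
  have hsplit : Ioc 0 T = Ioc 0 p ∪ (Ioc p q ∪ Ioc q T) := by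
    rw [Ioc_union_Ioc_eq_Ioc hpq hqT, Ioc_union_Ioc_eq_Ioc hp (hpq.trans hqT)]
  have hI : ∀ A B, IntegrableOn (fun s => |stepKer β p q s|) (Ioc A B) := fun A B =>
    (integrableOn_stepKer hβ hβ0).abs
  have d1 : Disjoint (Ioc 0 p) (Ioc p q ∪ Ioc q T) := by
    rw [Ioc_union_Ioc_eq_Ioc hpq hqT]; exact Ioc_disjoint_Ioc_of_le le_rfl
  rw [hsplit, setIntegral_union d1 (measurableSet_Ioc.union measurableSet_Ioc) (hI _ _)
    ((hI _ _).union (hI _ _)), setIntegral_union (Ioc_disjoint_Ioc_of_le le_rfl) measurableSet_Ioc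
    (hI _ _) (hI _ _)]
  have e1 : ∫ s in Ioc 0 p, |stepKer β p q s| = 0 := by
    rw [setIntegral_congr_fun (g := fun _ => 0) measurableSet_Ioc (fun s hs => ?_)]
    · simp
    · simp only [stepKer]
      rw [truncPow_of_le hβ0 hs.2, truncPow_of_le hβ0 (hs.2.trans hpq)]; simp
  have e2 : ∫ s in Ioc p q, |stepKer β p q s| = (q - p) ^ (1 - β) / (1 - β) := by
    rw [← integral_truncPow hβ hpq]
    refine setIntegral_congr_fun measurableSet_Ioc (fun s hs => ?_)
    simp only [stepKer]
    rw [truncPow_of_le hβ0 hs.2, sub_zero, abs_of_nonneg (truncPow_nonneg _ _ _)]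
  have e3 : ∫ s in Ioc q T, |stepKer β p q s| ≤ (q - p) ^ (1 - β) / (1 - β) := by
    have h1 : ∫ s in Ioc q T, |stepKer β p q s|
        = ∫ s in Ioc q T, (truncPow β q s - truncPow β p s) := by
      refine setIntegral_congr_fun measurableSet_Ioc (fun s hs => ?_)
      simp only [stepKer]
      rw [abs_sub_comm, abs_of_nonneg]
      rw [truncPow_of_lt hs.1, truncPow_of_lt (hpq.trans_lt hs.1), sub_nonneg]
      exact Real.rpow_le_rpow_of_nonpos (by linarith [hs.1]) (by linarith) (by linarith)
    rw [h1, integral_sub (integrableOn_truncPow hβ hβ0) (integrableOn_truncPow hβ hβ0),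
      integral_truncPow hβ hqT]
    have h2 := setIntegral_union (Ioc_disjoint_Ioc_of_le (le_refl q)) measurableSet_Ioc
      (integrableOn_truncPow (p := p) hβ hβ0 (A := p) (B := q))
      (integrableOn_truncPow (p := p) hβ hβ0 (A := q) (B := T))
    rw [Ioc_union_Ioc_eq_Ioc hpq hqT, integral_truncPow hβ (hpq.trans hqT), integral_truncPow hβ hpq]
      at h2
    have h3 : (T - q) ^ (1 - β) / (1 - β) ≤ (T - p) ^ (1 - β) / (1 - β) := by
      gcongr
    linarith
  rw [e1, e2]
  calc _ ≤ 0 + ((q - p) ^ (1 - β) / (1 - β) + (q - p) ^ (1 - β) / (1 - β)) := by gcongr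
    _ = _ := by ring

/-! ### Right fractional derivatives of Hölder functions -/

/-- Global Hölder continuity of order `γ` with constant `K`. -/
def HolderBound (K γ : ℝ) (g : ℝ → ℝ) : Prop := ∀ s t, |g t - g s| ≤ K * |t - s| ^ γ

lemma HolderBound.continuous {K γ : ℝ} {g : ℝ → ℝ} (hg : HolderBound K γ g) (hγ : 0 < γ) :
    Continuous g := by
  rw [continuous_iff_continuousAt]
  intro s
  rw [ContinuousAt, tendsto_iff_norm_sub_tendsto_zero]
  have h : Tendsto (fun t => K * |t - s| ^ γ) (𝓝 s) (𝓝 (K * |s - s| ^ γ)) := by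
    have : Continuous fun t : ℝ => K * |t - s| ^ γ :=
      continuous_const.mul ((by fun_prop : Continuous fun t : ℝ => |t - s|).rpow_const
        fun _ => Or.inr hγ.le)
    exact this.tendsto s
  rw [sub_self, abs_zero, Real.zero_rpow hγ.ne', mul_zero] at h
  exact squeeze_zero (fun t => norm_nonneg _) (fun t => hg s t) h

lemma HolderBound.nonneg {K γ : ℝ} {g : ℝ → ℝ} (hg : HolderBound K γ g) : 0 ≤ K := by
  have := hg 0 1
  simp only [sub_zero, abs_one, Real.one_rpow, mul_one] at this
  exact (abs_nonneg _).trans this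

/-- The singular integral in the right fractional derivative. -/
def rightInt (b T : ℝ) (g : ℝ → ℝ) (s : ℝ) : ℝ := ∫ u in s..T, (g s - g u) / (u - s) ^ (b + 1)

lemma fracDerivRight_sub_const (b T : ℝ) (g : ℝ → ℝ) (s : ℝ) :
    fracDerivRight b T (fun r => g r - g T) s
      = (Real.Gamma (1 - b))⁻¹ * ((g s - g T) / (T - s) ^ b + b * rightInt b T g s) := by
  simp only [fracDerivRight, rightInt, sub_sub_sub_cancel_right]

lemma intervalIntegrable_shift_rpow {s T r : ℝ} (hr : -1 < r) :
    IntervalIntegrable (fun u => (u - s) ^ r) volume s T := by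
  have := (intervalIntegral.intervalIntegrable_rpow' (r := r) hr
    (a := 0) (b := T - s)).comp_sub_right s
  simpa using this

lemma integral_shift_rpow {s T r : ℝ} (hr : -1 < r) :
    ∫ u in s..T, (u - s) ^ r = (T - s) ^ (r + 1) / (r + 1) := by
  rw [intervalIntegral.integral_comp_sub_right (fun s => s ^ r) s, integral_rpow (by left; linarith),
    sub_self, Real.zero_rpow (by linarith), sub_zero]

lemma HolderBound.quotient_le {K γ b : ℝ} {g : ℝ → ℝ} (hg : HolderBound K γ g) {s u : ℝ}
    (hsu : s < u) : |(g s - g u) / (u - s) ^ (b + 1)| ≤ K * (u - s) ^ (γ - (b + 1)) := by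
  have h : 0 < u - s := by linarith
  rw [abs_div, abs_of_nonneg (Real.rpow_nonneg h.le (b + 1)), Real.rpow_sub h, ← mul_div_assoc]
  gcongr
  have := hg u s
  rwa [abs_sub_comm s u, abs_of_pos h] at this

lemma HolderBound.intervalIntegrable_quotient {K γ b : ℝ} {g : ℝ → ℝ} (hg : HolderBound K γ g)
    (hγ : 0 < γ) (hb : b < γ) {s T : ℝ} (hsT : s ≤ T) :
    IntervalIntegrable (fun u => (g s - g u) / (u - s) ^ (b + 1)) volume s T := by
  refine ((intervalIntegrable_shift_rpow (r := γ - (b + 1)) (by linarith)).const_mul K).mono_fun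
    ?_ ?_
  · have := (hg.continuous hγ).measurable
    exact Measurable.aestronglyMeasurable (by fun_prop)
  · rw [uIoc_of_le hsT]
    filter_upwards [ae_restrict_mem measurableSet_Ioc] with u hu
    rw [Real.norm_eq_abs, Real.norm_eq_abs]
    exact (hg.quotient_le hu.1).trans (le_abs_self _)

lemma HolderBound.abs_rightInt_le {K γ b : ℝ} {g : ℝ → ℝ} (hg : HolderBound K γ g)
    (hb : b < γ) {s T : ℝ} (hsT : s ≤ T) :
    |rightInt b T g s| ≤ K * ((T - s) ^ (γ - b) / (γ - b)) := by
  have h := intervalIntegral.norm_integral_le_of_norm_le (μ := volume) hsT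
    (f := fun u => (g s - g u) / (u - s) ^ (b + 1)) (g := fun u => K * (u - s) ^ (γ - (b + 1)))
    (Eventually.of_forall fun u hu => hg.quotient_le hu.1)
    ((intervalIntegrable_shift_rpow (r := γ - (b + 1)) (by linarith)).const_mul K)
  rwa [intervalIntegral.integral_const_mul, integral_shift_rpow (by linarith),
    show γ - (b + 1) + 1 = γ - b by ring] at h

/-- Both terms are of order `(T - s) ^ (γ - b)`. The bound sees `g` only through `K` and `γ`, so it
can dominate a whole family of approximations. -/
lemma HolderBound.abs_fracDerivRight_le {K γ b : ℝ} {g : ℝ → ℝ} (hg : HolderBound K γ g)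
    (hb0 : 0 < b) (hb1 : b < 1) (hb : b < γ) {A s T : ℝ} (hAs : A ≤ s) (hsT : s < T) :
    |fracDerivRight b T (fun r => g r - g T) s|
      ≤ (Real.Gamma (1 - b))⁻¹ * (K * (T - A) ^ (γ - b) + b * (K * ((T - A) ^ (γ - b) / (γ - b)))) := by
  have hK := hg.nonneg
  have hG : 0 < Real.Gamma (1 - b) := Real.Gamma_pos_of_pos (by linarith)
  have hd : 0 < T - s := by linarith
  have hgb : 0 < γ - b := by linarith
  have h1 : |(g s - g T) / (T - s) ^ b| ≤ K * (T - s) ^ (γ - b) := by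
    rw [abs_div, abs_of_nonneg (Real.rpow_nonneg hd.le b), Real.rpow_sub hd, ← mul_div_assoc]
    gcongr
    have := hg T s
    rwa [abs_sub_comm s T, abs_of_pos hd] at this
  have h2 : (T - s) ^ (γ - b) ≤ (T - A) ^ (γ - b) := by gcongr
  rw [fracDerivRight_sub_const, abs_mul, abs_of_pos (inv_pos.2 hG)]
  gcongr
  refine (abs_add_le _ _).trans (add_le_add (h1.trans (by gcongr)) ?_)
  rw [abs_mul, abs_of_pos hb0]
  gcongr
  exact (hg.abs_rightInt_le hb hsT.le).trans (by gcongr)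

lemma aestronglyMeasurable_fracDerivRight {b T : ℝ} {g : ℝ → ℝ} (hg : Continuous g) {S : Set ℝ}
    (hS : MeasurableSet S) (hST : ∀ s ∈ S, s ≤ T) :
    AEStronglyMeasurable (fracDerivRight b T (fun r => g r - g T)) (volume.restrict S) := by
  have hgm := hg.measurable
  have hm : Measurable (fun z : ℝ × ℝ =>
      {z : ℝ × ℝ | z.1 < z.2 ∧ z.2 ≤ T}.indicator
        (fun z => (g z.1 - g z.2) / (z.2 - z.1) ^ (b + 1)) z) := by
    refine Measurable.indicator (by fun_prop) ?_
    exact (measurableSet_lt measurable_fst measurable_snd).inter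
      (measurableSet_le measurable_snd measurable_const)
  have h1 := (hm.stronglyMeasurable.integral_prod_right' (ν := (volume : Measure ℝ))).measurable
  have h2 : Measurable fun s => (Real.Gamma (1 - b))⁻¹ * ((g s - g T) / (T - s) ^ b + b *
      ∫ u, {z : ℝ × ℝ | z.1 < z.2 ∧ z.2 ≤ T}.indicator
        (fun z => (g z.1 - g z.2) / (z.2 - z.1) ^ (b + 1)) (s, u)) := by
    fun_prop
  refine h2.aestronglyMeasurable.congr ?_
  filter_upwards [ae_restrict_mem hS] with s hs
  rw [fracDerivRight_sub_const, rightInt, intervalIntegral.integral_of_le (hST s hs),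
    ← integral_indicator measurableSet_Ioc]
  rfl

/-! ### Abel inversion of the right fractional derivative -/

/-- Integration by parts for the right fractional derivative of a `C¹` function. -/
lemma fracDerivRight_of_hasDerivAt {b T M : ℝ} {g g' : ℝ → ℝ} (hb1 : b < 1)
    (hg : ∀ u, HasDerivAt g (g' u) u) (hg' : Continuous g') (hL : HolderBound M 1 g)
    {s : ℝ} (hsT : s < T) :
    fracDerivRight b T (fun r => g r - g T) s
      = -((Real.Gamma (1 - b))⁻¹ * ∫ u in s..T, g' u * (u - s) ^ (-b)) := by
  have hgc : Continuous g := hL.continuous one_pos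
  have i1 : IntervalIntegrable (fun u => g' u * (u - s) ^ (-b)) volume s T :=
    (intervalIntegrable_shift_rpow (by linarith)).continuousOn_mul hg'.continuousOn
  have i1' : IntervalIntegrable (fun u => -(g' u * (u - s) ^ (-b))) volume s T := i1.neg
  have i2 := hL.intervalIntegrable_quotient (b := b) one_pos hb1 hsT.le
  -- The primitive vanishes at `u = s`. It is continuous there because the Lipschitz bound gives `M
  -- * (u - s) ^ (1 - b)`, which tends to zero.
  have hF := intervalIntegral.integral_eq_sub_of_hasDerivAt_of_le
    (f := fun u => (g s - g u) * (u - s) ^ (-b))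
    (f' := fun u => -(g' u * (u - s) ^ (-b)) - b * ((g s - g u) / (u - s) ^ (b + 1))) hsT.le
    ?_ ?_ (i1'.sub (i2.const_mul b))
  · rw [intervalIntegral.integral_sub i1' (i2.const_mul b), intervalIntegral.integral_neg,
      intervalIntegral.integral_const_mul] at hF
    rw [fracDerivRight_sub_const, rightInt, div_eq_mul_inv, ← Real.rpow_neg (by linarith)]
    rw [sub_self, sub_self, zero_mul, sub_zero] at hF
    rw [← hF]
    ring
  · intro u hu
    rcases eq_or_lt_of_le hu.1 with rfl | hsu
    · rw [ContinuousWithinAt, tendsto_iff_norm_sub_tendsto_zero]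
      simp only [sub_self, zero_mul, sub_zero]
      have hc : Tendsto (fun u => M * |u - s| ^ (1 - b)) (𝓝 s) (𝓝 (M * |s - s| ^ (1 - b))) := by
        have : Continuous fun t : ℝ => M * |t - s| ^ (1 - b) :=
          continuous_const.mul ((by fun_prop : Continuous fun t : ℝ => |t - s|).rpow_const
            fun _ => Or.inr (by linarith))
        exact this.tendsto s
      rw [sub_self, abs_zero, Real.zero_rpow (by linarith), mul_zero] at hc
      refine squeeze_zero' (Eventually.of_forall fun _ => norm_nonneg _) ?_
        (hc.mono_left nhdsWithin_le_nhds)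
      filter_upwards [self_mem_nhdsWithin] with v hv
      rcases eq_or_lt_of_le hv.1 with rfl | hsv
      · simp [Real.zero_rpow (show 1 - b ≠ 0 by linarith)]
      · have hd : 0 < v - s := by linarith
        have := hL v s
        rw [abs_sub_comm s v, abs_of_pos hd, Real.rpow_one] at this
        rw [norm_mul, Real.norm_eq_abs, Real.norm_eq_abs, abs_of_pos hd,
          abs_of_nonneg (Real.rpow_nonneg hd.le _)]
        calc _ ≤ M * (v - s) * (v - s) ^ (-b) := by gcongr
          _ = _ := by rw [sub_eq_add_neg 1 b, Real.rpow_add hd, Real.rpow_one]; ring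
    · apply ContinuousAt.continuousWithinAt
      refine (continuousAt_const.sub hgc.continuousAt).mul ?_
      exact ContinuousAt.rpow_const (by fun_prop) (Or.inl (by linarith))
  · intro u hu
    have hd : 0 < u - s := by linarith [hu.1]
    have h1 : HasDerivAt (fun u => g s - g u) (-g' u) u := by simpa using (hg u).const_sub (g s)
    have h2 : HasDerivAt (fun u => (u - s) ^ (-b)) (1 * (-b) * (u - s) ^ (-b - 1)) u :=
      ((hasDerivAt_id u).sub_const s).rpow_const (Or.inl hd.ne')
    refine (h1.mul h2).congr_deriv ?_
    rw [div_eq_mul_inv, ← Real.rpow_neg hd.le, show -(b + 1) = -b - 1 by ring]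
    ring

/-- This is the Beta integral `B(b, 1 - b)`; the exponents add up to `-1`, so the length `u - a`
scales out. -/
lemma integral_rpow_mul_rpow {b a u : ℝ} (hb0 : 0 < b) (hb1 : b < 1) (hau : a < u) :
    ∫ s in a..u, (s - a) ^ (b - 1) * (u - s) ^ (-b) = Real.Gamma b * Real.Gamma (1 - b) := by
  have hd : 0 < u - a := by linarith
  have h0 : ∫ s in a..u, (s - a) ^ (b - 1) * (u - s) ^ (-b)
      = ∫ x in (0 : ℝ)..(u - a), x ^ (b - 1) * ((u - a) - x) ^ (-b) := by
    have := intervalIntegral.integral_comp_sub_right (a := a) (b := u)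
      (fun x => x ^ (b - 1) * ((u - a) - x) ^ (-b)) a
    simpa using this
  rw [h0]
  have h1 := Complex.betaIntegral_scaled (b : ℂ) ((1 - b : ℝ) : ℂ) hd
  have h2 := Complex.Gamma_mul_Gamma_eq_betaIntegral (s := (b : ℂ)) (t := ((1 - b : ℝ) : ℂ))
    (by simpa using hb0) (by simpa using hb1)
  have h3 : (b : ℂ) + ((1 - b : ℝ) : ℂ) = 1 := by push_cast; ring
  rw [h3, Complex.Gamma_one, one_mul] at h2
  rw [h3, sub_self, Complex.cpow_zero, one_mul, ← h2, Complex.Gamma_ofReal, Complex.Gamma_ofReal] at h1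
  have h4 : (∫ x in (0 : ℝ)..(u - a), (x : ℂ) ^ ((b : ℂ) - 1) *
      (((u - a : ℝ) : ℂ) - x) ^ (((1 - b : ℝ) : ℂ) - 1))
      = ((∫ x in (0 : ℝ)..(u - a), x ^ (b - 1) * ((u - a) - x) ^ (-b) : ℝ) : ℂ) := by
    rw [← intervalIntegral.integral_ofReal]
    refine intervalIntegral.integral_congr fun x hx => ?_
    rw [uIcc_of_le hd.le] at hx
    rw [Complex.ofReal_mul, Complex.ofReal_cpow hx.1, Complex.ofReal_cpow (by linarith [hx.2])]
    push_cast
    ring_nf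
  rw [h4] at h1
  exact_mod_cast h1

/-- A non-integrable function would have Bochner integral `0`, but the value just computed is
positive. -/
lemma integrableOn_rpow_mul_rpow {b a u : ℝ} (hb0 : 0 < b) (hb1 : b < 1) (hau : a < u) :
    IntegrableOn (fun s => (s - a) ^ (b - 1) * (u - s) ^ (-b)) (Ioc a u) := by
  by_contra h
  have h1 := integral_rpow_mul_rpow hb0 hb1 hau
  rw [intervalIntegral.integral_of_le hau.le, integral_undef h] at h1
  have := mul_pos (Real.Gamma_pos_of_pos hb0) (Real.Gamma_pos_of_pos (show 0 < 1 - b by linarith))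
  linarith

/-- Interchange of the two Abel integrals. -/
lemma integral_abel_abel {b a T : ℝ} (hb0 : 0 < b) (hb1 : b < 1) {h : ℝ → ℝ} (hh : Continuous h)
    (haT : a ≤ T) :
    ∫ s in a..T, (s - a) ^ (b - 1) * ∫ u in s..T, h u * (u - s) ^ (-b)
      = Real.Gamma b * Real.Gamma (1 - b) * ∫ u in a..T, h u := by
  set B := Real.Gamma b * Real.Gamma (1 - b) with hB
  set S : Set (ℝ × ℝ) := {z | a < z.1 ∧ z.1 ≤ z.2 ∧ z.2 ≤ T} with hS
  have hSm : MeasurableSet S := (measurableSet_lt measurable_const measurable_fst).inter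
    ((measurableSet_le measurable_fst measurable_snd).inter
      (measurableSet_le measurable_snd measurable_const))
  set F : ℝ → ℝ → ℝ := fun s u =>
    S.indicator (fun z => (z.1 - a) ^ (b - 1) * (h z.2 * (z.2 - z.1) ^ (-b))) (s, u) with hF
  have hFm : Measurable (Function.uncurry F) := by
    have := hh.measurable
    exact Measurable.indicator (by fun_prop) hSm
  have eF : ∀ u s, F s u = (Ioc a T).indicator h u *
      (Ioc a u).indicator (fun s => (s - a) ^ (b - 1) * (u - s) ^ (-b)) s := by
    intro u s
    simp only [hF, indicator, hS, mem_ofPred_eq, mem_Ioc]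
    by_cases h1 : a < s <;> by_cases h2 : s ≤ u <;> by_cases h3 : u ≤ T <;>
      simp [h1, h2, h3]
    rw [if_pos (by linarith)]
    ring
  have iu : ∀ u, Integrable (fun s => F s u) := by
    intro u
    simp only [eF]
    apply Integrable.const_mul
    rw [integrable_indicator_iff measurableSet_Ioc]
    rcases le_or_gt u a with hua | hua
    · rw [Ioc_eq_empty (by linarith)]; exact integrableOn_empty
    · exact integrableOn_rpow_mul_rpow hb0 hb1 hua
  have Iu : ∀ u, ∫ s, F s u = B * (Ioc a T).indicator h u := by
    intro u
    simp only [eF]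
    rw [integral_const_mul, integral_indicator measurableSet_Ioc]
    by_cases hu : u ∈ Ioc a T
    · rw [← intervalIntegral.integral_of_le hu.1.le, integral_rpow_mul_rpow hb0 hb1 hu.1, mul_comm]
    · rw [indicator_of_notMem hu]; simp
  have hnF : ∀ u s, ‖F s u‖ = (Ioc a T).indicator (fun u => |h u|) u *
      (Ioc a u).indicator (fun s => (s - a) ^ (b - 1) * (u - s) ^ (-b)) s := by
    intro u s
    rw [eF, Real.norm_eq_abs, abs_mul, abs_of_nonneg (indicator_nonneg (fun s hs => ?_) s)]
    · congr 1
      simp only [indicator]; split_ifs <;> simp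
    · exact mul_nonneg (Real.rpow_nonneg (by linarith [hs.1]) _)
        (Real.rpow_nonneg (by linarith [hs.2]) _)
  have Inu : ∀ u, ∫ s, ‖F s u‖ = B * (Ioc a T).indicator (fun u => |h u|) u := by
    intro u
    simp only [hnF]
    rw [integral_const_mul, integral_indicator measurableSet_Ioc]
    by_cases hu : u ∈ Ioc a T
    · rw [← intervalIntegral.integral_of_le hu.1.le, integral_rpow_mul_rpow hb0 hb1 hu.1, mul_comm]
    · rw [indicator_of_notMem hu]; simp
  -- Fubini is justified by integrating the norm in `s` first: the Beta integral leaves a constant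
  -- times `|h|` on `(a, T]`.
  have hint : Integrable (Function.uncurry F) (volume.prod volume) := by
    rw [integrable_prod_iff' hFm.aestronglyMeasurable]
    refine ⟨Eventually.of_forall iu, ?_⟩
    simp only [Function.uncurry_apply_pair, Inu]
    apply Integrable.const_mul
    rw [integrable_indicator_iff measurableSet_Ioc]
    exact (hh.abs.continuousOn.integrableOn_Icc).mono_set Ioc_subset_Icc_self
  have hswap := integral_integral_swap hint
  simp only [Iu] at hswap
  rw [integral_const_mul, integral_indicator measurableSet_Ioc,
    ← intervalIntegral.integral_of_le haT] at hswap
  rw [← hswap, intervalIntegral.integral_of_le haT, ← integral_indicator measurableSet_Ioc]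
  refine integral_congr_ae (Eventually.of_forall fun s => ?_)
  simp only
  by_cases hs : s ∈ Ioc a T
  · rw [indicator_of_mem hs, intervalIntegral.integral_of_le hs.2, ← integral_Icc_eq_integral_Ioc,
      ← integral_const_mul, ← integral_indicator measurableSet_Icc]
    refine integral_congr_ae (Eventually.of_forall fun u => ?_)
    simp only [hF, indicator, hS, mem_ofPred_eq, mem_Icc, hs.1, true_and]
  · rw [indicator_of_notMem hs]
    refine (integral_eq_zero_of_ae (Eventually.of_forall fun u => ?_)).symm
    simp only [hF, Pi.zero_apply]
    refine indicator_of_notMem (fun hz => hs ⟨hz.1, hz.2.1.trans hz.2.2⟩) _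

lemma integral_rpow_mul_fracDerivRight_of_hasDerivAt {b a T M : ℝ} {g g' : ℝ → ℝ} (hb0 : 0 < b)
    (hb1 : b < 1) (hg : ∀ u, HasDerivAt g (g' u) u) (hg' : Continuous g')
    (hL : HolderBound M 1 g) (haT : a ≤ T) :
    ∫ s in Ioo a T, (s - a) ^ (b - 1) * fracDerivRight b T (fun r => g r - g T) s
      = Real.Gamma b * (g a - g T) := by
  have h1 : ∫ s in Ioo a T, (s - a) ^ (b - 1) * fracDerivRight b T (fun r => g r - g T) s
      = ∫ s in Ioo a T, -(Real.Gamma (1 - b))⁻¹ *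
        ((s - a) ^ (b - 1) * ∫ u in s..T, g' u * (u - s) ^ (-b)) := by
    refine setIntegral_congr_fun measurableSet_Ioo fun s hs => ?_
    rw [fracDerivRight_of_hasDerivAt hb1 hg hg' hL hs.2]
    ring
  have hG : 0 < Real.Gamma (1 - b) := Real.Gamma_pos_of_pos (by linarith)
  rw [h1, integral_const_mul, ← integral_Ioc_eq_integral_Ioo, ← intervalIntegral.integral_of_le haT,
    integral_abel_abel hb0 hb1 hg' haT,
    intervalIntegral.integral_eq_sub_of_hasDerivAt (fun u _ => hg u) (hg'.intervalIntegrable _ _)]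
  field_simp
  ring

/-- The Steklov mean of `g` over `[s, s + ε]`. -/
def steklov (ε : ℝ) (g : ℝ → ℝ) (s : ℝ) : ℝ := ε⁻¹ * ∫ u in s..s + ε, g u

lemma hasDerivAt_steklov {ε : ℝ} {g : ℝ → ℝ} (hg : Continuous g) (s : ℝ) :
    HasDerivAt (steklov ε g) (ε⁻¹ * (g (s + ε) - g s)) s := by
  have h1 : ∀ s, HasDerivAt (fun s => ∫ u in (0 : ℝ)..s, g u) (g s) s := fun s =>
    intervalIntegral.integral_hasDerivAt_right (hg.intervalIntegrable _ _)
      hg.stronglyMeasurable.stronglyMeasurableAtFilter hg.continuousAt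
  have h2 : steklov ε g = fun s => ε⁻¹ * ((∫ u in (0 : ℝ)..s + ε, g u) - ∫ u in (0 : ℝ)..s, g u) := by
    ext s
    rw [steklov, intervalIntegral.integral_interval_sub_left (hg.intervalIntegrable _ _)
      (hg.intervalIntegrable _ _)]
  rw [h2]
  exact (((h1 (s + ε)).comp_add_const s ε).sub (h1 s)).const_mul _

/-- An average of translates keeps the Hölder constant, so later bounds are uniform in `ε`. -/
lemma HolderBound.steklov {K γ ε : ℝ} {g : ℝ → ℝ} (hg : HolderBound K γ g) (hγ : 0 < γ)
    (hε : 0 < ε) : HolderBound K γ (steklov ε g) := by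
  intro s t
  have hc := hg.continuous hγ
  have e : ∀ s, GaussRep.steklov ε g s = ε⁻¹ * ∫ x in (0 : ℝ)..ε, g (x + s) := by
    intro s
    rw [GaussRep.steklov, intervalIntegral.integral_comp_add_right, zero_add, add_comm]
  have hci : ∀ s, IntervalIntegrable (fun x => g (x + s)) volume 0 ε := fun s =>
    (hc.comp (continuous_id.add continuous_const)).intervalIntegrable _ _
  rw [e, e, ← mul_sub, ← intervalIntegral.integral_sub (hci t) (hci s), abs_mul,
    abs_of_pos (inv_pos.2 hε)]
  have := intervalIntegral.norm_integral_le_of_norm_le_const (a := 0) (b := ε)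
    (f := fun x => g (x + t) - g (x + s)) (C := K * |t - s| ^ γ) (fun x _ => by
      have := hg (x + s) (x + t)
      rwa [add_sub_add_left_eq_sub] at this)
  rw [sub_zero, abs_of_pos hε, Real.norm_eq_abs] at this
  calc _ ≤ ε⁻¹ * (K * |t - s| ^ γ * ε) := by gcongr
    _ = _ := by field_simp

lemma HolderBound.abs_steklov_sub_le {K γ ε : ℝ} {g : ℝ → ℝ} (hg : HolderBound K γ g) (hγ : 0 < γ)
    (hε : 0 < ε) (s : ℝ) : |GaussRep.steklov ε g s - g s| ≤ K * ε ^ γ := by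
  have hc := hg.continuous hγ
  have hK := hg.nonneg
  have e : GaussRep.steklov ε g s - g s = ε⁻¹ * ∫ u in s..s + ε, (g u - g s) := by
    rw [GaussRep.steklov, intervalIntegral.integral_sub (hc.intervalIntegrable _ _) (by simp)]
    simp
    field_simp
  rw [e, abs_mul, abs_of_pos (inv_pos.2 hε)]
  have := intervalIntegral.norm_integral_le_of_norm_le_const (a := s) (b := s + ε)
    (f := fun u => g u - g s) (C := K * ε ^ γ) (fun u hu => by
      rw [uIoc_of_le (by linarith)] at hu
      refine (hg s u).trans ?_
      rw [abs_of_pos (by linarith [hu.1])]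
      have : 0 ≤ u - s := by linarith [hu.1]
      gcongr
      linarith [hu.2])
  rw [add_sub_cancel_left, abs_of_pos hε, Real.norm_eq_abs] at this
  calc _ ≤ ε⁻¹ * (K * ε ^ γ * ε) := by gcongr
    _ = _ := by field_simp

/-- The constant may blow up as `ε → 0`; it only licenses the integration by parts for fixed `ε`. -/
lemma HolderBound.lipschitz_steklov {K γ ε : ℝ} {g : ℝ → ℝ} (hg : HolderBound K γ g) (hγ : 0 < γ)
    (hε : 0 < ε) : HolderBound (ε⁻¹ * (K * ε ^ γ)) 1 (GaussRep.steklov ε g) := by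
  intro s t
  have hd := fun s => hasDerivAt_steklov (ε := ε) (hg.continuous hγ) s
  have := Convex.norm_image_sub_le_of_norm_hasDerivWithin_le (f := GaussRep.steklov ε g)
    (C := ε⁻¹ * (K * ε ^ γ)) (s := univ) (x := s) (y := t)
    (fun x _ => (hd x).hasDerivWithinAt) (fun x _ => ?_) convex_univ (mem_univ _) (mem_univ _)
  · rwa [Real.rpow_one]
  · rw [norm_mul, Real.norm_eq_abs, abs_of_pos (inv_pos.2 hε)]
    have := hg x (x + ε)
    rw [add_sub_cancel_left, abs_of_pos hε] at this
    gcongr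
    exact this

/-- The Abel integral inverts the right fractional derivative of a Hölder function. -/
theorem HolderBound.integral_rpow_mul_fracDerivRight {K γ b a T : ℝ} {g : ℝ → ℝ}
    (hg : HolderBound K γ g) (hb0 : 0 < b) (hb1 : b < 1) (hbγ : b < γ) (haT : a ≤ T) :
    ∫ s in Ioo a T, (s - a) ^ (b - 1) * fracDerivRight b T (fun r => g r - g T) s
      = Real.Gamma b * (g a - g T) := by
  have hγ : 0 < γ := hb0.trans hbγ
  have hc := hg.continuous hγ
  set ε : ℕ → ℝ := fun n => 1 / ((n : ℝ) + 1) with hεdef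
  have hε : ∀ n, 0 < ε n := fun n => Nat.one_div_pos_of_nat
  have hε0 : Tendsto ε atTop (𝓝 0) := tendsto_one_div_add_atTop_nhds_zero_nat
  set G : ℕ → ℝ → ℝ := fun n => GaussRep.steklov (ε n) g with hGdef
  have hGH : ∀ n, HolderBound K γ (G n) := fun n => hg.steklov hγ (hε n)
  have hGt : ∀ s, Tendsto (fun n => G n s) atTop (𝓝 (g s)) := by
    intro s
    rw [tendsto_iff_norm_sub_tendsto_zero]
    have h : Tendsto (fun n => K * ε n ^ γ) atTop (𝓝 (K * 0 ^ γ)) :=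
      (hε0.rpow_const (Or.inr hγ.le)).const_mul K
    rw [Real.zero_rpow hγ.ne', mul_zero] at h
    exact squeeze_zero (fun n => norm_nonneg _) (fun n => hg.abs_steklov_sub_le hγ (hε n) s) h
  have hGe : ∀ n, ∫ s in Ioo a T, (s - a) ^ (b - 1) * fracDerivRight b T (fun r => G n r - G n T) s
      = Real.Gamma b * (G n a - G n T) := fun n =>
    integral_rpow_mul_fracDerivRight_of_hasDerivAt hb0 hb1 (fun u => hasDerivAt_steklov hc u)
      (by fun_prop) (hg.lipschitz_steklov hγ (hε n)) haT
  have hlim1 : Tendsto (fun n => Real.Gamma b * (G n a - G n T)) atTop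
      (𝓝 (Real.Gamma b * (g a - g T))) := ((hGt a).sub (hGt T)).const_mul _
  -- Both passages to the limit, inside the derivative and in the outer integral, are dominated
  -- thanks to the Hölder constant `K` common to all Steklov means.
  have hpt : ∀ s < T, Tendsto (fun n => fracDerivRight b T (fun r => G n r - G n T) s) atTop
      (𝓝 (fracDerivRight b T (fun r => g r - g T) s)) := by
    intro s hs
    simp only [fracDerivRight_sub_const]
    refine ((((hGt s).sub (hGt T)).div_const _).add (Tendsto.const_mul _ ?_)).const_mul _
    refine intervalIntegral.tendsto_integral_filter_of_dominated_convergence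
      (fun u => K * (u - s) ^ (γ - (b + 1))) (Eventually.of_forall fun n => ?_)
      (Eventually.of_forall fun n => Eventually.of_forall fun u hu => ?_)
      ((intervalIntegrable_shift_rpow (by linarith)).const_mul K)
      (Eventually.of_forall fun u hu => ((hGt s).sub (hGt u)).div_const _)
    · have := ((hGH n).continuous hγ).measurable
      exact Measurable.aestronglyMeasurable (by fun_prop)
    · rw [uIoc_of_le hs.le] at hu
      exact (hGH n).quotient_le hu.1
  have hlim2 : Tendsto (fun n => ∫ s in Ioo a T, (s - a) ^ (b - 1) *
      fracDerivRight b T (fun r => G n r - G n T) s) atTop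
      (𝓝 (∫ s in Ioo a T, (s - a) ^ (b - 1) * fracDerivRight b T (fun r => g r - g T) s)) := by
    refine tendsto_integral_of_dominated_convergence
      (fun s => (s - a) ^ (b - 1) * ((Real.Gamma (1 - b))⁻¹ *
        (K * (T - a) ^ (γ - b) + b * (K * ((T - a) ^ (γ - b) / (γ - b)))))) (fun n => ?_) ?_
      (fun n => ?_) ?_
    · exact (Measurable.aestronglyMeasurable (by fun_prop)).mul
        (aestronglyMeasurable_fracDerivRight ((hGH n).continuous hγ) measurableSet_Ioo
          fun s hs => hs.2.le)
    · apply Integrable.mul_const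
      have := (intervalIntegrable_iff_integrableOn_Ioc_of_le haT).1
        (intervalIntegrable_shift_rpow (s := a) (T := T) (r := b - 1) (by linarith))
      exact this.mono_set Ioo_subset_Ioc_self
    · filter_upwards [ae_restrict_mem measurableSet_Ioo] with s hs
      have h0 : 0 ≤ (s - a) ^ (b - 1) := Real.rpow_nonneg (by linarith [hs.1]) _
      rw [norm_mul, Real.norm_eq_abs, abs_of_nonneg h0]
      exact mul_le_mul_of_nonneg_left
        ((hGH n).abs_fracDerivRight_le hb0 hb1 hbγ hs.1.le hs.2) h0
    · filter_upwards [ae_restrict_mem measurableSet_Ioo] with s hs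
      exact (hpt s hs.2).const_mul _
  simp only [hGe] at hlim2
  exact tendsto_nhds_unique hlim2 hlim1

/-! ### Step functions with jumps accumulating at the right endpoint -/

lemma integrable_of_hasSum {S : Type*} [MeasurableSpace S] {ν : Measure S} {F : ℕ → S → ℝ}
    {f : S → ℝ} (hF : ∀ i, Integrable (F i) ν) (hsum : Summable fun i => ∫ a, ‖F i a‖ ∂ν)
    (h : ∀ᵐ a ∂ν, HasSum (fun i => F i a) (f a)) : Integrable f ν := by
  refine ⟨aestronglyMeasurable_of_tendsto_ae atTop
    (f := fun n a => ∑ i ∈ Finset.range n, F i a) (fun n => ?_) ?_, ?_⟩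
  · exact Finset.aestronglyMeasurable_fun_sum _ fun i _ => (hF i).1
  · filter_upwards [h] with a ha using ha.tendsto_sum_nat
  · have h1 : ∫⁻ a, ‖f a‖ₑ ∂ν ≤ ∫⁻ a, ∑' i, ‖F i a‖ₑ ∂ν := by
      refine lintegral_mono_ae ?_
      filter_upwards [h] with a ha
      rw [← ha.tsum_eq]
      exact enorm_tsum_le_tsum_enorm
    refine h1.trans_lt ?_
    rw [lintegral_tsum fun i => (hF i).1.enorm]
    have h2 : ∀ i, ∫⁻ a, ‖F i a‖ₑ ∂ν = ENNReal.ofReal (∫ a, ‖F i a‖ ∂ν) := fun i =>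
      (ofReal_integral_norm_eq_lintegral_enorm (hF i)).symm
    simp only [h2]
    exact hsum.tsum_ofReal_lt_top

/-- The step function with value `c k` on `(s k, s (k + 1)]`. -/
def stepFun (s c : ℕ → ℝ) (t : ℝ) : ℝ := ∑' k, c k * unitStep (s k) (s (k + 1)) t

section Step

variable {s c : ℕ → ℝ} {T β : ℝ}

lemma unitStep_eq_zero_of_le {p q t : ℝ} (h : t ≤ p) : unitStep p q t = 0 :=
  indicator_of_notMem (fun h' => absurd h'.1 (not_lt.2 h)) _

lemma unitStep_eq_zero_of_lt {p q t : ℝ} (h : q < t) : unitStep p q t = 0 :=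
  indicator_of_notMem (fun h' => absurd h'.2 (not_le.2 h)) _

lemma hasSum_stepFun_of_le (hs : Monotone s) {N : ℕ} {t : ℝ} (ht : t ≤ s N) :
    HasSum (fun k => c k * unitStep (s k) (s (k + 1)) t)
      (∑ k ∈ Finset.range N, c k * unitStep (s k) (s (k + 1)) t) := by
  refine hasSum_sum_of_ne_finset_zero fun k hk => ?_
  rw [unitStep_eq_zero_of_le (ht.trans (hs (by simpa using hk))), mul_zero]

lemma stepFun_of_le (hs : Monotone s) {N : ℕ} {t : ℝ} (ht : t ≤ s N) :
    stepFun s c t = ∑ k ∈ Finset.range N, c k * unitStep (s k) (s (k + 1)) t :=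
  (hasSum_stepFun_of_le hs ht).tsum_eq

lemma exists_le_of_lt (hT : Tendsto s atTop (𝓝 T)) {t : ℝ} (ht : t < T) : ∃ N, t ≤ s N :=
  ((hT.eventually_const_lt ht).exists).imp fun _ h => h.le

/-- Below `T` only finitely many steps have begun; from `T` on every step is over, so the series is
zero. -/
lemma summable_stepFun (hs : Monotone s) (hlt : ∀ k, s k < T) (hT : Tendsto s atTop (𝓝 T)) (t : ℝ) :
    Summable (fun k => c k * unitStep (s k) (s (k + 1)) t) := by
  rcases lt_or_ge t T with ht | ht
  · obtain ⟨N, hN⟩ := exists_le_of_lt hT ht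
    exact (hasSum_stepFun_of_le hs hN).summable
  · have : (fun k => c k * unitStep (s k) (s (k + 1)) t) = fun _ => 0 := by
      ext k
      rw [unitStep_eq_zero_of_lt ((hlt _).trans_le ht), mul_zero]
    rw [this]
    exact summable_zero

lemma measurable_stepFun (hs : Monotone s) (hlt : ∀ k, s k < T) (hT : Tendsto s atTop (𝓝 T)) :
    Measurable (stepFun s c) := by
  refine measurable_of_tendsto_metrizable
    (f := fun n t => ∑ k ∈ Finset.range n, c k * unitStep (s k) (s (k + 1)) t) (fun n => ?_) ?_
  · refine Finset.measurable_fun_sum _ fun k _ => ?_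
    exact (measurable_const.indicator measurableSet_Ioc).const_mul _
  · rw [tendsto_pi_nhds]
    exact fun t => (summable_stepFun hs hlt hT t).hasSum.tendsto_sum_nat

lemma stepKer_eq_zero_of_le (hβ : 0 < β) {p q t : ℝ} (hpq : p ≤ q) (ht : t ≤ p) :
    stepKer β p q t = 0 := by
  rw [stepKer, truncPow_of_le hβ ht, truncPow_of_le hβ (ht.trans hpq), sub_zero]

/-- The left derivative at `t < T` looks only to the left of `t`, where the step function is a
finite sum, so linearity suffices and no limit is interchanged. -/
lemma hasSum_fracDerivLeft_stepFun (hβ : 0 < β) (hs : Monotone s) (hs0 : 0 ≤ s 0)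
    (hT : Tendsto s atTop (𝓝 T)) {t : ℝ} (ht0 : 0 < t) (htT : t < T) (hts : ∀ k, t ≠ s k) :
    HasSum (fun k => c k * ((Real.Gamma (1 - β))⁻¹ * stepKer β (s k) (s (k + 1)) t))
      (fracDerivLeft β (stepFun s c) t) := by
  obtain ⟨N, hN⟩ := exists_le_of_lt hT htT
  have h0 : ∀ k, 0 ≤ s k := fun k => hs0.trans (hs k.zero_le)
  have e : fracDerivLeft β (stepFun s c) t
      = ∑ k ∈ Finset.range N, c k * ((Real.Gamma (1 - β))⁻¹ * stepKer β (s k) (s (k + 1)) t) := by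
    have hq := fun k => unitStep_quotient (β := β) hβ (h0 k) (hs k.le_succ) (hts (k + 1))
    have h1 : ∫ u in Ioc 0 t, (stepFun s c t - stepFun s c u) / (t - u) ^ (β + 1)
        = ∑ k ∈ Finset.range N, c k *
          ∫ u in Ioc 0 t, (unitStep (s k) (s (k + 1)) t - unitStep (s k) (s (k + 1)) u)
            / (t - u) ^ (β + 1) := by
      simp only [← integral_const_mul]
      rw [← integral_finsetSum _ fun k _ => ((hq k).1).const_mul (c k)]
      refine setIntegral_congr_fun measurableSet_Ioc fun u hu => ?_
      rw [stepFun_of_le hs hN, stepFun_of_le hs (hu.2.trans hN), ← Finset.sum_sub_distrib,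
        Finset.sum_div]
      exact Finset.sum_congr rfl fun k _ => by ring
    rw [fracDerivLeft, intervalIntegral.integral_of_le ht0.le, h1, stepFun_of_le hs hN,
      Finset.sum_div, Finset.mul_sum, ← Finset.sum_add_distrib, Finset.mul_sum]
    refine Finset.sum_congr rfl fun k _ => ?_
    rw [(hq k).2.1, Real.rpow_neg ht0.le]
    field_simp
    ring
  rw [e]
  refine hasSum_sum_of_ne_finset_zero fun k hk => ?_
  rw [stepKer_eq_zero_of_le hβ (hs k.le_succ) (hN.trans (hs (by simpa using hk)))]
  simp

lemma lintegral_mul_abs_stepKer_le {p q a : ℝ} (hβ0 : 0 < β) (hβ : β < 1) (hp : 0 ≤ p) (hpq : p ≤ q)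
    (hqT : q ≤ T) (ha : 0 ≤ a) :
    ∫⁻ t in Ioc 0 T, ENNReal.ofReal (a * |stepKer β p q t|)
      ≤ ENNReal.ofReal (2 / (1 - β) * (a * (q - p) ^ (1 - β))) := by
  rw [← ofReal_integral_eq_lintegral_ofReal ((integrableOn_stepKer hβ hβ0).abs.const_mul a)
    (Eventually.of_forall fun t => mul_nonneg ha (abs_nonneg _)), integral_const_mul]
  refine ENNReal.ofReal_le_ofReal ?_
  calc _ ≤ a * (2 / (1 - β) * (q - p) ^ (1 - β)) := by
        gcongr; exact integral_abs_stepKer_le hβ0 hβ hp hpq hqT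
    _ = _ := by ring

/-- Tonelli reduces the claim to the `L¹` norms of the kernels. The same series dominates both
halves of the Besov norm. -/
lemma lintegral_tsum_stepKer_lt_top (hβ0 : 0 < β) (hβ : β < 1) (hs : Monotone s)
    (hs0 : 0 ≤ s 0) (hlt : ∀ k, s k < T) {a : ℕ → ℝ} (ha : ∀ k, 0 ≤ a k)
    (hsum : Summable fun k => a k * (s (k + 1) - s k) ^ (1 - β)) :
    ∫⁻ t in Ioc 0 T, ∑' k, ENNReal.ofReal (a k * |stepKer β (s k) (s (k + 1)) t|) < ⊤ := by
  rw [lintegral_tsum fun k =>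
    ((measurable_stepKer _ _ _).abs.const_mul _).ennreal_ofReal.aemeasurable]
  refine lt_of_le_of_lt (ENNReal.tsum_le_tsum fun k => lintegral_mul_abs_stepKer_le hβ0 hβ
    (hs0.trans (hs k.zero_le)) (hs k.le_succ) (hlt _).le (ha k)) ?_
  exact (hsum.mul_left _).tsum_ofReal_lt_top

lemma ae_restrict_ne (S : Set ℝ) : ∀ᵐ t ∂(volume.restrict S), t ≠ T ∧ ∀ k, t ≠ s k := by
  refine ae_restrict_of_ae ?_
  rw [eventually_and, ae_all_iff]
  exact ⟨Measure.ae_ne _ _, fun k => Measure.ae_ne _ _⟩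

/-- On its own interval a unit step over `t ^ β` is at most the kernel, because `t - s k ≤ t`; in
the double integral the inner integral of each step is at most `β⁻¹` times the kernel. -/
lemma memBesov_stepFun (hβ0 : 0 < β) (hβ : β < 1) (hs : Monotone s)
    (hs0 : 0 ≤ s 0) (hlt : ∀ k, s k < T) (hT : Tendsto s atTop (𝓝 T))
    (hsum : Summable fun k => |c k| * (s (k + 1) - s k) ^ (1 - β)) :
    MemBesov β T (stepFun s c) := by
  have h0 : ∀ k, 0 ≤ s k := fun k => hs0.trans (hs k.zero_le)
  refine ⟨(measurable_stepFun hs hlt hT).comp measurable_subtype_coe, ENNReal.add_lt_top.2 ⟨?_, ?_⟩⟩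
  · refine lt_of_le_of_lt (lintegral_mono_ae ?_)
      (lintegral_tsum_stepKer_lt_top hβ0 hβ hs hs0 hlt (fun k => abs_nonneg (c k)) hsum)
    filter_upwards [ae_restrict_mem measurableSet_Ioc, ae_restrict_ne (s := s) (T := T) (Ioc 0 T)]
      with t ht htne
    obtain ⟨N, hN⟩ := exists_le_of_lt hT (lt_of_le_of_ne ht.2 htne.1)
    have hp : 0 < t ^ β := Real.rpow_pos_of_pos ht.1 β
    calc _ ≤ ENNReal.ofReal (∑ k ∈ Finset.range N, |c k| * |stepKer β (s k) (s (k + 1)) t|) := by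
          refine ENNReal.ofReal_le_ofReal ?_
          rw [stepFun_of_le hs hN, div_le_iff₀ hp, Finset.sum_mul]
          refine (Finset.abs_sum_le_sum_abs _ _).trans (Finset.sum_le_sum fun k _ => ?_)
          rw [abs_mul, mul_assoc]
          gcongr
          by_cases hk : t ∈ Ioc (s k) (s (k + 1))
          · rw [unitStep, indicator_of_mem hk, abs_one, stepKer, truncPow_of_lt hk.1,
              truncPow_of_le hβ0 hk.2, sub_zero, ← div_le_iff₀ hp, one_div, ← Real.rpow_neg ht.1.le]
            refine le_trans ?_ (le_abs_self _)
            exact Real.rpow_le_rpow_of_nonpos (by linarith [hk.1]) (by linarith [h0 k])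
              (by linarith)
          · rw [unitStep, indicator_of_notMem hk, abs_zero]; positivity
      _ = ∑ k ∈ Finset.range N, ENNReal.ofReal (|c k| * |stepKer β (s k) (s (k + 1)) t|) :=
          ENNReal.ofReal_sum_of_nonneg fun k _ => by positivity
      _ ≤ _ := ENNReal.sum_le_tsum _
  · have hsum' : Summable fun k => (β⁻¹ * |c k|) * (s (k + 1) - s k) ^ (1 - β) := by
      simpa only [mul_assoc] using hsum.mul_left β⁻¹
    refine lt_of_le_of_lt (lintegral_mono_ae ?_)
      (lintegral_tsum_stepKer_lt_top hβ0 hβ hs hs0 hlt (fun k => by positivity) hsum')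
    filter_upwards [ae_restrict_mem measurableSet_Ioc, ae_restrict_ne (s := s) (T := T) (Ioc 0 T)]
      with t ht htne
    obtain ⟨N, hN⟩ := exists_le_of_lt hT (lt_of_le_of_ne ht.2 htne.1)
    have hq := fun k => unitStep_quotient (β := β) hβ0 (h0 k) (hs k.le_succ) (htne.2 (k + 1))
    have hint : ∀ k, IntegrableOn (fun u => |c k| * |(unitStep (s k) (s (k + 1)) t
        - unitStep (s k) (s (k + 1)) u) / (t - u) ^ (β + 1)|) (Ioc 0 t) :=
      fun k => ((hq k).1).abs.const_mul _
    calc _ ≤ ∫⁻ u in Ioc 0 t, ENNReal.ofReal (∑ k ∈ Finset.range N, |c k| *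
            |(unitStep (s k) (s (k + 1)) t - unitStep (s k) (s (k + 1)) u) / (t - u) ^ (β + 1)|) := by
          refine setLIntegral_mono' measurableSet_Ioc fun u hu => ENNReal.ofReal_le_ofReal ?_
          have hd : 0 ≤ (t - u) ^ (β + 1) := Real.rpow_nonneg (by linarith [hu.2]) _
          rw [abs_sub_comm, stepFun_of_le hs hN, stepFun_of_le hs (hu.2.trans hN),
            ← Finset.sum_sub_distrib, add_comm 1 β]
          calc _ ≤ (∑ k ∈ Finset.range N, |c k| *
                |unitStep (s k) (s (k + 1)) t - unitStep (s k) (s (k + 1)) u|) /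
                (t - u) ^ (β + 1) := by
                gcongr
                refine (Finset.abs_sum_le_sum_abs _ _).trans (le_of_eq ?_)
                exact Finset.sum_congr rfl fun k _ => by rw [← mul_sub, abs_mul]
            _ = _ := by
                rw [Finset.sum_div]
                exact Finset.sum_congr rfl fun k _ => by rw [abs_div, abs_of_nonneg hd, mul_div_assoc]
      _ = ENNReal.ofReal (∑ k ∈ Finset.range N, |c k| * ∫ u in Ioc 0 t,
            |(unitStep (s k) (s (k + 1)) t - unitStep (s k) (s (k + 1)) u) / (t - u) ^ (β + 1)|) := by
          rw [← ofReal_integral_eq_lintegral_ofReal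
            (integrable_finsetSum _ fun k _ => hint k)
            (Eventually.of_forall fun u => Finset.sum_nonneg fun k _ => by positivity),
            integral_finsetSum _ fun k _ => hint k]
          simp only [integral_const_mul]
      _ ≤ ENNReal.ofReal (∑ k ∈ Finset.range N,
            (β⁻¹ * |c k|) * |stepKer β (s k) (s (k + 1)) t|) := by
          refine ENNReal.ofReal_le_ofReal (Finset.sum_le_sum fun k _ => ?_)
          rw [mul_comm β⁻¹, mul_assoc]
          gcongr
          exact (hq k).2.2
      _ = ∑ k ∈ Finset.range N, ENNReal.ofReal
            ((β⁻¹ * |c k|) * |stepKer β (s k) (s (k + 1)) t|) :=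
          ENNReal.ofReal_sum_of_nonneg fun k _ => by positivity
      _ ≤ _ := ENNReal.sum_le_tsum _

/-- Abel inversion with `b = 1 - β`, applied from `p` and from `q`. The increment comes out
reversed, which the minus sign in the definition of the integral corrects. -/
lemma HolderBound.integral_stepKer_mul {K γ p q : ℝ} {g : ℝ → ℝ} (hg : HolderBound K γ g)
    (hβ0 : 0 < β) (hβ : β < 1) (hγ : 1 - β < γ) (hp : 0 ≤ p) (hpq : p ≤ q) (hqT : q ≤ T) :
    IntegrableOn (fun t => ((Real.Gamma (1 - β))⁻¹ * stepKer β p q t) *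
      fracDerivRight (1 - β) T (fun r => g r - g T) t) (Ioo 0 T) ∧
    ∫ t in Ioo 0 T, ((Real.Gamma (1 - β))⁻¹ * stepKer β p q t) *
      fracDerivRight (1 - β) T (fun r => g r - g T) t = g p - g q := by
  set R := fracDerivRight (1 - β) T (fun r => g r - g T) with hR
  have hb0 : 0 < 1 - β := by linarith
  have hb1 : 1 - β < 1 := by linarith
  have hint : ∀ p, IntegrableOn (fun t => truncPow β p t * R t) (Ioo 0 T) := by
    intro p
    refine Integrable.mul_bdd (c := (Real.Gamma (1 - (1 - β)))⁻¹ * (K * (T - 0) ^ (γ - (1 - β))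
        + (1 - β) * (K * ((T - 0) ^ (γ - (1 - β)) / (γ - (1 - β))))))
      ((integrableOn_truncPow hβ hβ0).mono_set Ioo_subset_Ioc_self) ?_ ?_
    · exact aestronglyMeasurable_fracDerivRight (hg.continuous (by linarith)) measurableSet_Ioo
        fun t ht => ht.2.le
    · filter_upwards [ae_restrict_mem measurableSet_Ioo] with t ht
      exact hg.abs_fracDerivRight_le hb0 hb1 hγ ht.1.le ht.2
  have hval : ∀ p, 0 ≤ p → p ≤ T → ∫ t in Ioo 0 T, truncPow β p t * R t
      = Real.Gamma (1 - β) * (g p - g T) := by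
    intro p hp hpT
    rw [← hg.integral_rpow_mul_fracDerivRight hb0 hb1 hγ hpT]
    rw [setIntegral_eq_of_subset_of_forall_sdiff_eq_zero (s := Ioo p T) measurableSet_Ioo
      (Ioo_subset_Ioo_left hp) fun t ht => ?_]
    · refine setIntegral_congr_fun measurableSet_Ioo fun t ht => ?_
      rw [truncPow_of_lt ht.1, show 1 - β - 1 = -β by ring]
    · have : t ≤ p := by
        by_contra h
        exact ht.2 ⟨not_le.1 h, ht.1.2⟩
      rw [truncPow_of_le hβ0 this, zero_mul]
  have hG : 0 < Real.Gamma (1 - β) := Real.Gamma_pos_of_pos hb0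
  have e : (fun t => ((Real.Gamma (1 - β))⁻¹ * stepKer β p q t) * R t)
      = fun t => (Real.Gamma (1 - β))⁻¹ * (truncPow β p t * R t - truncPow β q t * R t) := by
    ext t
    rw [stepKer]
    ring
  rw [e]
  refine ⟨((hint p).sub (hint q)).const_mul _, ?_⟩
  rw [integral_const_mul, integral_sub (hint p) (hint q), hval p hp (hpq.trans hqT),
    hval q (hp.trans hpq) hqT]
  field_simp
  ring

/-- The generalized Lebesgue–Stieltjes integral of a step function whose jumps accumulate at the
right endpoint only, with respect to a globally Hölder function. -/
lemma HolderBound.integral_fracDerivLeft_stepFun {K γ : ℝ} {g : ℝ → ℝ} (hg : HolderBound K γ g)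
    (hβ0 : 0 < β) (hβ : β < 1) (hγ : 1 - β < γ) (hs : Monotone s) (hs0 : 0 ≤ s 0)
    (hlt : ∀ k, s k < T) (hT : Tendsto s atTop (𝓝 T))
    (hsum : Summable fun k => |c k| * (s (k + 1) - s k) ^ (1 - β)) :
    IntegrableOn (fun t => fracDerivLeft β (stepFun s c) t *
      fracDerivRight (1 - β) T (fun r => g r - g T) t) (Ioo 0 T) ∧
    HasSum (fun k => c k * (g (s (k + 1)) - g (s k))) (-∫ t in Ioo 0 T,
      fracDerivLeft β (stepFun s c) t * fracDerivRight (1 - β) T (fun r => g r - g T) t) := by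
  have h0 : ∀ k, 0 ≤ s k := fun k => hs0.trans (hs k.zero_le)
  set R := fracDerivRight (1 - β) T (fun r => g r - g T) with hR
  set H : ℕ → ℝ → ℝ := fun k t =>
    c k * (((Real.Gamma (1 - β))⁻¹ * stepKer β (s k) (s (k + 1)) t) * R t) with hH
  have hk := fun k => hg.integral_stepKer_mul (T := T) hβ0 hβ hγ (h0 k) (hs k.le_succ) (hlt _).le
  have hHi : ∀ k, IntegrableOn (H k) (Ioo 0 T) := fun k => (hk k).1.const_mul _
  have hHv : ∀ k, ∫ t in Ioo 0 T, H k t = c k * (g (s k) - g (s (k + 1))) := fun k => by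
    simp only [hH]
    rw [integral_const_mul, (hk k).2]
  set M := (Real.Gamma (1 - (1 - β)))⁻¹ * (K * (T - 0) ^ (γ - (1 - β))
        + (1 - β) * (K * ((T - 0) ^ (γ - (1 - β)) / (γ - (1 - β))))) with hM
  have hRM : ∀ t ∈ Ioo 0 T, |R t| ≤ M := fun t ht =>
    hg.abs_fracDerivRight_le (by linarith) (by linarith) hγ ht.1.le ht.2
  have hG : 0 < Real.Gamma (1 - β) := Real.Gamma_pos_of_pos (by linarith)
  have hM0 : 0 ≤ M := by
    have hT0 : 0 < T := (h0 0).trans_lt (hlt 0)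
    exact (abs_nonneg _).trans (hRM (T / 2) ⟨by linarith, by linarith⟩)
  -- The right derivative is bounded by `M`, so each term costs at most a constant times the `L¹`
  -- norm of its kernel.
  have hHs : Summable fun k => ∫ t in Ioo 0 T, ‖H k t‖ := by
    refine Summable.of_nonneg_of_le (fun k => integral_nonneg fun t => norm_nonneg _) (fun k => ?_)
      (hsum.mul_left ((Real.Gamma (1 - β))⁻¹ * M * (2 / (1 - β))))
    have hki : IntegrableOn (fun t => |stepKer β (s k) (s (k + 1)) t|) (Ioc 0 T) :=
      (integrableOn_stepKer hβ hβ0).abs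
    calc _ ≤ ∫ t in Ioo 0 T, (|c k| * (Real.Gamma (1 - β))⁻¹ * M) *
          |stepKer β (s k) (s (k + 1)) t| := by
          refine setIntegral_mono_on (hHi k).norm
            ((hki.mono_set Ioo_subset_Ioc_self).const_mul _) measurableSet_Ioo fun t ht => ?_
          simp only [hH, Real.norm_eq_abs, abs_mul, abs_inv, abs_of_pos hG]
          calc _ ≤ |c k| * ((Real.Gamma (1 - β))⁻¹ * |stepKer β (s k) (s (k + 1)) t| * M) := by
                gcongr
                exact hRM t ht
            _ = _ := by ring
      _ = (|c k| * (Real.Gamma (1 - β))⁻¹ * M) *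
          ∫ t in Ioc 0 T, |stepKer β (s k) (s (k + 1)) t| := by
          rw [integral_const_mul, integral_Ioc_eq_integral_Ioo]
      _ ≤ (|c k| * (Real.Gamma (1 - β))⁻¹ * M) * (2 / (1 - β) * (s (k + 1) - s k) ^ (1 - β)) := by
          gcongr
          exact integral_abs_stepKer_le hβ0 hβ (h0 k) (hs k.le_succ) (hlt _).le
      _ = _ := by ring
  have hpt : ∀ᵐ t ∂(volume.restrict (Ioo 0 T)),
      HasSum (fun k => H k t) (fracDerivLeft β (stepFun s c) t * R t) := by
    filter_upwards [ae_restrict_mem measurableSet_Ioo, ae_restrict_ne (s := s) (T := T) (Ioo 0 T)]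
      with t ht htne
    have := (hasSum_fracDerivLeft_stepFun (c := c) hβ0 hs hs0 hT ht.1 ht.2 htne.2).mul_right (R t)
    simpa only [hH, mul_assoc] using this
  refine ⟨integrable_of_hasSum hHi hHs hpt, ?_⟩
  have h1 := (hasSum_integral_of_summable_integral_norm hHi hHs).neg
  rw [integral_congr_ae (g := fun t => fracDerivLeft β (stepFun s c) t * R t)
    (hpt.mono fun t ht => ht.tsum_eq)] at h1
  simpa only [hHv, ← mul_neg, neg_sub] using h1

/-- Before the first jump the product of derivatives is zero, so no Hölder regularity of the
integrator is needed there. -/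
lemma fracDerivLeft_stepFun_of_le (hs : Monotone s) {t : ℝ} (ht0 : 0 ≤ t) (ht : t ≤ s 0) :
    fracDerivLeft β (stepFun s c) t = 0 := by
  have h : ∀ u ≤ s 0, stepFun s c u = 0 := fun u hu => by
    rw [stepFun_of_le hs hu, Finset.range_zero, Finset.sum_empty]
  rw [fracDerivLeft, h t ht, intervalIntegral.integral_congr (g := fun _ => 0)]
  · simp
  · intro u hu
    rw [uIcc_of_le ht0] at hu
    simp only
    rw [h u (hu.2.trans ht)]
    simp

lemma fracDerivRight_congr {b : ℝ} {g h : ℝ → ℝ} {A t : ℝ} (hgh : EqOn g h (Icc A T))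
    (ht : t ∈ Icc A T) :
    fracDerivRight b T (fun r => g r - g T) t = fracDerivRight b T (fun r => h r - h T) t := by
  have hT : T ∈ Icc A T := ⟨ht.1.trans ht.2, le_rfl⟩
  rw [fracDerivRight_sub_const, fracDerivRight_sub_const, hgh ht, hgh hT, rightInt, rightInt,
    intervalIntegral.integral_congr (g := fun u => (h t - h u) / (u - t) ^ (b + 1))]
  intro u hu
  rw [uIcc_of_le ht.2] at hu
  simp only
  rw [hgh ht, hgh ⟨ht.1.trans hu.1, hu.2⟩]

/-- The generalized Lebesgue–Stieltjes integral of a step function whose jumps accumulate at the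
right endpoint only. -/
theorem hasGLSIntegral_stepFun {K γ A I : ℝ} {x : ℝ → ℝ} (hx : ContinuousOn x (Icc 0 T))
    (hK : 0 ≤ K) (hxH : ∀ u ∈ Icc A T, ∀ v ∈ Icc A T, |x v - x u| ≤ K * |v - u| ^ γ)
    (hβ0 : 0 < β) (hβ : β < 1) (hγ : 1 - β < γ) (hs : Monotone s) (hA : 0 ≤ A) (hAs : A ≤ s 0)
    (hlt : ∀ k, s k < T) (hT : Tendsto s atTop (𝓝 T))
    (hsum : Summable fun k => |c k| * (s (k + 1) - s k) ^ (1 - β))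
    {φ : ℕ → ℕ} (hφ : Tendsto φ atTop atTop)
    (hI : Tendsto (fun n => ∑ k ∈ Finset.range (φ n), c k * (x (s (k + 1)) - x (s k))) atTop
      (𝓝 I)) :
    HasGLSIntegral β (stepFun s c) x T I := by
  have hAT : A ≤ T := hAs.trans (hlt 0).le
  -- Freezing `x` outside `[A, T]` makes it globally Hölder, as the projection is 1-Lipschitz.
  -- Nothing is lost: the right derivative at `t ≥ A` sees only `[A, T]`, and the left one vanishes
  -- before `s 0 ≥ A`.
  set g : ℝ → ℝ := fun t => x (projIcc A T hAT t) with hgdef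
  have hgx : EqOn x g (Icc A T) := fun t ht => by
    simp only [hgdef]
    rw [projIcc_of_mem hAT ht]
  have hg : HolderBound K γ g := by
    intro u v
    refine (hxH _ (projIcc A T hAT u).2 _ (projIcc A T hAT v).2).trans ?_
    have : |(projIcc A T hAT v : ℝ) - projIcc A T hAT u| ≤ |v - u| := abs_projIcc_sub_projIcc hAT
    have hγ0 : 0 < γ := by linarith
    gcongr
  have hsI : ∀ k, s k ∈ Icc A T := fun k => ⟨hAs.trans (hs k.zero_le), (hlt k).le⟩
  obtain ⟨h1, h2⟩ := hg.integral_fracDerivLeft_stepFun (c := c) hβ0 hβ hγ hs (hA.trans hAs) hlt hT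
    hsum
  have heq : ∀ t ∈ Ioo 0 T, fracDerivLeft β (stepFun s c) t *
      fracDerivRight (1 - β) T (fun r => x r - x T) t = fracDerivLeft β (stepFun s c) t *
      fracDerivRight (1 - β) T (fun r => g r - g T) t := by
    intro t ht
    rcases le_or_gt t (s 0) with h | h
    · rw [fracDerivLeft_stepFun_of_le hs ht.1.le h, zero_mul, zero_mul]
    · rw [fracDerivRight_congr hgx ⟨hAs.trans h.le, ht.2.le⟩]
  refine ⟨⟨hβ0, hβ⟩, hx, memBesov_stepFun hβ0 hβ hs (hA.trans hAs) hlt hT hsum, ?_, ?_, ?_⟩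
  · filter_upwards [ae_restrict_mem measurableSet_Ioo] with t ht hne
    have hts : A ≤ t := by
      by_contra h
      exact hne (fracDerivLeft_stepFun_of_le hs ht.1.le ((not_le.1 h).le.trans hAs))
    refine (hg.intervalIntegrable_quotient (b := 1 - β) (by linarith) hγ ht.2.le).congr ?_
    intro u hu
    rw [uIoc_of_le ht.2.le] at hu
    simp only
    rw [hgx ⟨hts, ht.2.le⟩, hgx ⟨hts.trans hu.1.le, hu.2⟩]
  · exact h1.congr_fun (fun t ht => (heq t ht).symm) measurableSet_Ioo
  · rw [setIntegral_congr_fun measurableSet_Ioo heq]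
    -- The full series is already known to converge to the integral, so a subsequence of partial
    -- sums identifies the value.
    refine tendsto_nhds_unique (h2.tendsto_sum_nat.comp hφ) ?_
    refine hI.congr fun n => Finset.sum_congr rfl fun k _ => ?_
    rw [hgx (hsI _), hgx (hsI _)]

end Step

/-! ### The betting strategy along a single path -/

/-- The grid `T - δ / k`, which accumulates at `T`. -/
def gridPt (T δ : ℝ) (k : ℕ) : ℝ := T - δ / k

/-- The level at which betting stops in the `n`-th stage. -/
def hitLevel (θ : ℝ) (n : ℕ) : ℝ := ((2 : ℝ) ^ n) ^ (-θ)

/-- The increment of `x` since the beginning of the stage containing the `k`-th grid point. -/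
def stageDev (T δ : ℝ) (x : ℝ → ℝ) (k : ℕ) : ℝ :=
  x (gridPt T δ k) - x (gridPt T δ (2 ^ Nat.log 2 k))

open Classical in
/-- The unit bet at the `k`-th grid point. It is proportional to the increment since the beginning
of the stage, until this increment exceeds the hitting level. -/
def unitBet (T δ θ : ℝ) (x : ℝ → ℝ) (k : ℕ) : ℝ :=
  if ∀ j ∈ Finset.Icc (2 ^ Nat.log 2 k) k,
      |x (gridPt T δ j) - x (gridPt T δ (2 ^ Nat.log 2 k))| < hitLevel θ (Nat.log 2 k) then
    2 * stageDev T δ x k / hitLevel θ (Nat.log 2 k) ^ 2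
  else 0

/-- The gain from the unit bets in the `n`-th stage. -/
def stageGain (T δ θ : ℝ) (x : ℝ → ℝ) (n : ℕ) : ℝ :=
  ∑ k ∈ Finset.Ico (2 ^ n) (2 ^ (n + 1)),
    unitBet T δ θ x k * (x (gridPt T δ (k + 1)) - x (gridPt T δ k))

/-- The distance between the target and the wealth at the beginning of the `n`-th stage. -/
def stageErr (T δ θ : ℝ) (x z : ℝ → ℝ) : ℕ → ℝ
  | 0 => z (gridPt T δ 1)
  | n + 1 => (1 - stageGain T δ θ x n) * stageErr T δ θ x z n +
      (z (gridPt T δ (2 ^ (n + 1))) - z (gridPt T δ (2 ^ n)))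

/-- The bet at the `k`-th grid point. -/
def bet (T δ θ : ℝ) (x z : ℝ → ℝ) (k : ℕ) : ℝ :=
  stageErr T δ θ x z (Nat.log 2 k) * unitBet T δ θ x k

section Strategy

variable {T δ θ : ℝ} {x z : ℝ → ℝ}

lemma hitLevel_pos (θ : ℝ) (n : ℕ) : 0 < hitLevel θ n := by unfold hitLevel; positivity

lemma log_of_mem_Ico {n k : ℕ} (h : k ∈ Finset.Ico (2 ^ n) (2 ^ (n + 1))) : Nat.log 2 k = n :=
  Nat.log_eq_of_pow_le_of_lt_pow (Finset.mem_Ico.1 h).1 (Finset.mem_Ico.1 h).2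

/-- Index `0` is excluded: `δ / 0 = 0` would put `gridPt T δ 0` at `T`. -/
lemma gridPt_mono (hδ : 0 ≤ δ) {j k : ℕ} (hj : 1 ≤ j) (hjk : j ≤ k) :
    gridPt T δ j ≤ gridPt T δ k := by
  unfold gridPt
  have : (0 : ℝ) < j := by exact_mod_cast hj
  gcongr

lemma gridPt_mem (hδ : 0 ≤ δ) {k : ℕ} (hk : 1 ≤ k) : gridPt T δ k ∈ Icc (T - δ) T := by
  refine ⟨?_, ?_⟩
  · simpa [gridPt] using gridPt_mono (T := T) hδ le_rfl hk
  · unfold gridPt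
    have : 0 ≤ δ / k := by positivity
    linarith

lemma gridPt_lt (hδ : 0 < δ) {k : ℕ} (hk : 1 ≤ k) : gridPt T δ k < T := by
  unfold gridPt
  have : (0 : ℝ) < k := by exact_mod_cast hk
  have : 0 < δ / k := by positivity
  linarith

lemma gridPt_succ_sub {k : ℕ} (hk : 1 ≤ k) :
    gridPt T δ (k + 1) - gridPt T δ k = δ / (k * (k + 1)) := by
  unfold gridPt
  have : (0 : ℝ) < k := by exact_mod_cast hk
  push_cast
  field_simp
  ring

/-- The wealth of the strategy at the beginning of a stage. -/
lemma sum_bet (n : ℕ) : ∑ k ∈ Finset.Ico 1 (2 ^ n), bet T δ θ x z k *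
    (x (gridPt T δ (k + 1)) - x (gridPt T δ k)) = z (gridPt T δ (2 ^ n)) - stageErr T δ θ x z n := by
  induction n with
  | zero => simp [stageErr]
  | succ n ih =>
    rw [← Finset.sum_Ico_consecutive _ Nat.one_le_two_pow
      (Nat.pow_le_pow_right two_pos n.le_succ), ih, stageErr]
    have : ∑ k ∈ Finset.Ico (2 ^ n) (2 ^ (n + 1)), bet T δ θ x z k *
        (x (gridPt T δ (k + 1)) - x (gridPt T δ k))
        = stageErr T δ θ x z n * stageGain T δ θ x n := by
      rw [stageGain, Finset.mul_sum]
      refine Finset.sum_congr rfl fun k hk => ?_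
      rw [bet, log_of_mem_Ico hk, mul_assoc]
    rw [this]
    ring

/-- A discrete Itô formula: each `D (k+1) ^ 2 - D k ^ 2` is `2 * D k` times the increment plus the
squared increment. -/
lemma sum_two_mul_sub (D : ℕ → ℝ) {b m : ℕ} (h : b ≤ m) :
    ∑ k ∈ Finset.Ico b m, 2 * D k * (D (k + 1) - D k)
      = D m ^ 2 - D b ^ 2 - ∑ k ∈ Finset.Ico b m, (D (k + 1) - D k) ^ 2 := by
  induction m, h using Nat.le_induction with
  | base => simp
  | succ m hm ih => rw [Finset.sum_Ico_succ_top hm, Finset.sum_Ico_succ_top hm, ih]; ring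

/-- If the hitting level is reached in a stage, then the gain of the unit bets is close to one. -/
lemma abs_stageGain_sub_one_le {n : ℕ} {w : ℝ} (hw : 0 ≤ w)
    (hinc : ∀ k ∈ Finset.Ico (2 ^ n) (2 ^ (n + 1)),
      |x (gridPt T δ (k + 1)) - x (gridPt T δ k)| ≤ w)
    (hhit : ∃ j ∈ Finset.Icc (2 ^ n) (2 ^ (n + 1)),
      hitLevel θ n ≤ |x (gridPt T δ j) - x (gridPt T δ (2 ^ n))|) :
    |stageGain T δ θ x n - 1| ≤ 2 * (w / hitLevel θ n) + (1 + 2 ^ n) * (w / hitLevel θ n) ^ 2 := by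
  set h := hitLevel θ n with hh
  have hpos : 0 < h := hitLevel_pos θ n
  set D : ℕ → ℝ := fun j => x (gridPt T δ j) - x (gridPt T δ (2 ^ n)) with hD
  -- `τ` is the first hitting index. The stopping test at `k` includes `j = k`, so bets are placed
  -- exactly for `k < τ`.
  obtain ⟨τ, ⟨hτm, hτ⟩, hmin⟩ : ∃ τ, (τ ∈ Finset.Icc (2 ^ n) (2 ^ (n + 1)) ∧ h ≤ |D τ|) ∧
      ∀ j < τ, ¬ (j ∈ Finset.Icc (2 ^ n) (2 ^ (n + 1)) ∧ h ≤ |D j|) := by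
    classical
    have hex : ∃ j, j ∈ Finset.Icc (2 ^ n) (2 ^ (n + 1)) ∧ h ≤ |D j| := hhit
    exact ⟨Nat.find hex, Nat.find_spec hex, fun j hj => Nat.find_min hex hj⟩
  rw [Finset.mem_Icc] at hτm
  have hD0 : D (2 ^ n) = 0 := sub_self _
  have hbτ : 2 ^ n < τ := by
    refine lt_of_le_of_ne hτm.1 fun he => ?_
    rw [← he, hD0, abs_zero] at hτ
    linarith
  have hlt : ∀ j, 2 ^ n ≤ j → j < τ → |D j| < h := fun j h1 h2 => by
    by_contra hc
    exact hmin j h2 ⟨Finset.mem_Icc.2 ⟨h1, h2.le.trans hτm.2⟩, not_lt.1 hc⟩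
  have hdD : ∀ k, D (k + 1) - D k = x (gridPt T δ (k + 1)) - x (gridPt T δ k) := fun k => by
    simp only [hD]; ring
  have hgain : stageGain T δ θ x n
      = (D τ ^ 2 - ∑ k ∈ Finset.Ico (2 ^ n) τ, (D (k + 1) - D k) ^ 2) / h ^ 2 := by
    have h1 := sum_two_mul_sub D hbτ.le
    rw [hD0, zero_pow two_ne_zero, sub_zero] at h1
    rw [← h1, stageGain, ← Finset.sum_Ico_consecutive _ hbτ.le hτm.2, Finset.sum_div]
    have h2 : ∑ k ∈ Finset.Ico τ (2 ^ (n + 1)),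
        unitBet T δ θ x k * (x (gridPt T δ (k + 1)) - x (gridPt T δ k)) = 0 := by
      refine Finset.sum_eq_zero fun k hk => ?_
      rw [Finset.mem_Ico] at hk
      rw [unitBet, if_neg, zero_mul]
      rw [log_of_mem_Ico (Finset.mem_Ico.2 ⟨hτm.1.trans hk.1, hk.2⟩)]
      intro hall
      exact absurd (hall τ (Finset.mem_Icc.2 ⟨hτm.1, hk.1⟩)) (not_lt.2 hτ)
    rw [h2, add_zero]
    refine Finset.sum_congr rfl fun k hk => ?_
    rw [Finset.mem_Ico] at hk
    have hlog := log_of_mem_Ico (Finset.mem_Ico.2 ⟨hk.1, hk.2.trans_le hτm.2⟩)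
    rw [unitBet, if_pos, stageDev, hlog, hdD]
    · ring
    · rw [hlog]
      intro j hj
      rw [Finset.mem_Icc] at hj
      exact hlt j hj.1 (hj.2.trans_lt hk.2)
  -- The level is overshot by at most the last increment; `(h + w) ^ 2 - h ^ 2` yields the terms `2
  -- * h * w` and `w ^ 2` of the bound.
  have hDτ : |D τ| ≤ h + w := by
    obtain ⟨m, rfl⟩ : ∃ m, τ = m + 1 := ⟨τ - 1, by omega⟩
    have h1 := hlt m (by omega) (by omega)
    have h2 := hinc m (Finset.mem_Ico.2 ⟨by omega, by omega⟩)
    rw [← hdD] at h2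
    calc |D (m + 1)| = |D m + (D (m + 1) - D m)| := by ring_nf
      _ ≤ |D m| + |D (m + 1) - D m| := abs_add_le _ _
      _ ≤ h + w := by linarith
  have hQ0 : 0 ≤ ∑ k ∈ Finset.Ico (2 ^ n) τ, (D (k + 1) - D k) ^ 2 :=
    Finset.sum_nonneg fun k _ => sq_nonneg _
  have hQ : ∑ k ∈ Finset.Ico (2 ^ n) τ, (D (k + 1) - D k) ^ 2 ≤ 2 ^ n * w ^ 2 := by
    calc _ ≤ ∑ k ∈ Finset.Ico (2 ^ n) τ, w ^ 2 := by
          refine Finset.sum_le_sum fun k hk => ?_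
          rw [Finset.mem_Ico] at hk
          rw [hdD, ← sq_abs]
          have := hinc k (Finset.mem_Ico.2 ⟨hk.1, hk.2.trans_le hτm.2⟩)
          gcongr
      _ = ((τ - 2 ^ n : ℕ) : ℝ) * w ^ 2 := by rw [Finset.sum_const, Nat.card_Ico, nsmul_eq_mul]
      _ ≤ 2 ^ n * w ^ 2 := by
          gcongr
          have : τ - 2 ^ n ≤ 2 ^ n := by
            have := hτm.2
            rw [pow_succ] at this
            omega
          exact_mod_cast this
  have hsq1 : h ^ 2 ≤ D τ ^ 2 := by rw [← sq_abs (D τ)]; gcongr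
  have hsq2 : D τ ^ 2 ≤ (h + w) ^ 2 := by rw [← sq_abs (D τ)]; gcongr
  have he : stageGain T δ θ x n - 1
      = ((D τ ^ 2 - h ^ 2) - ∑ k ∈ Finset.Ico (2 ^ n) τ, (D (k + 1) - D k) ^ 2) / h ^ 2 := by
    rw [hgain]; field_simp; ring
  have hr : 2 * (w / h) + (1 + 2 ^ n) * (w / h) ^ 2
      = (2 * h * w + (1 + 2 ^ n) * w ^ 2) / h ^ 2 := by field_simp
  rw [he, hr, abs_div, abs_of_pos (pow_pos hpos 2)]
  gcongr
  rw [abs_le]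
  have hn : (0 : ℝ) ≤ 2 ^ n * w ^ 2 := by positivity
  have hhw : 0 ≤ 2 * h * w := by positivity
  constructor <;> nlinarith [sq_nonneg w]

lemma gridPt_succ_sub_le (hδ : 0 ≤ δ) {n k : ℕ} (hk : 2 ^ n ≤ k) :
    gridPt T δ (k + 1) - gridPt T δ k ≤ δ * ((2 : ℝ) ^ n) ^ (-2 : ℝ) := by
  have hk1 : 1 ≤ k := Nat.one_le_two_pow.trans hk
  have hkr : (2 : ℝ) ^ n ≤ k := by exact_mod_cast hk
  have hy : (0 : ℝ) < 2 ^ n := by positivity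
  rw [gridPt_succ_sub hk1, Real.rpow_neg hy.le, ← div_eq_mul_inv]
  norm_cast
  push_cast
  gcongr
  nlinarith

/-- A point of a stage interval is close to a grid point. -/
lemma exists_gridPt_near (hδ : 0 < δ) {n : ℕ} {v : ℝ}
    (hv : v ∈ Icc (gridPt T δ (2 ^ n)) (gridPt T δ (2 ^ (n + 1)))) :
    ∃ j ∈ Finset.Icc (2 ^ n) (2 ^ (n + 1)), |v - gridPt T δ j| ≤ δ * ((2 : ℝ) ^ n) ^ (-2 : ℝ) := by
  have hy : (0 : ℝ) < 2 ^ n := by positivity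
  have hvT : 0 < T - v := by
    have := hv.2.trans_lt (gridPt_lt (T := T) hδ (Nat.one_le_two_pow (n := n + 1)))
    linarith
  -- `w` is the real index of `v`, that is, `v = T - δ / w`; the grid point sought is the one with
  -- index `⌊w⌋₊`.
  set w := δ / (T - v) with hw
  have hvw : v = T - δ / w := by rw [hw]; field_simp; ring
  have hwpos : 0 < w := by positivity
  have h1 : (2 : ℝ) ^ n ≤ w := by
    have := hv.1
    rw [gridPt] at this
    push_cast at this
    rw [hw, le_div_iff₀ hvT]
    have h2 : T - v ≤ δ / 2 ^ n := by linarith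
    rw [le_div_iff₀ hy] at h2
    linarith
  have h2 : w ≤ 2 ^ (n + 1) := by
    have := hv.2
    rw [gridPt] at this
    push_cast at this
    rw [hw, div_le_iff₀ hvT]
    have h2 : δ / 2 ^ (n + 1) ≤ T - v := by linarith
    rw [div_le_iff₀ (by positivity)] at h2
    linarith
  have hj1 : 2 ^ n ≤ ⌊w⌋₊ := Nat.le_floor (by exact_mod_cast h1)
  have hj2 : ⌊w⌋₊ ≤ 2 ^ (n + 1) := by
    have : (⌊w⌋₊ : ℝ) ≤ 2 ^ (n + 1) := (Nat.floor_le hwpos.le).trans h2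
    exact_mod_cast this
  refine ⟨⌊w⌋₊, Finset.mem_Icc.2 ⟨hj1, hj2⟩, ?_⟩
  have hjr : (2 : ℝ) ^ n ≤ ⌊w⌋₊ := by exact_mod_cast hj1
  have hjpos : (0 : ℝ) < ⌊w⌋₊ := hy.trans_le hjr
  have hfl := Nat.floor_le hwpos.le
  have hfl2 := Nat.lt_floor_add_one w
  have e : v - gridPt T δ ⌊w⌋₊ = δ * (w - ⌊w⌋₊) / (⌊w⌋₊ * w) := by
    rw [gridPt, hvw]; field_simp; ring
  rw [e, abs_of_nonneg (by have : 0 ≤ w - ⌊w⌋₊ := by linarith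
                           positivity), Real.rpow_neg hy.le, ← div_eq_mul_inv]
  norm_cast
  push_cast
  have h3 : δ * (w - ⌊w⌋₊) ≤ δ := by nlinarith
  gcongr
  nlinarith

lemma tendsto_two_pow_rpow {e : ℝ} (he : e < 0) :
    Tendsto (fun n : ℕ => ((2 : ℝ) ^ n) ^ e) atTop (𝓝 0) := by
  have h := tendsto_rpow_neg_atTop (y := -e) (by linarith)
  rw [neg_neg] at h
  exact h.comp (tendsto_pow_atTop_atTop_of_one_lt one_lt_two)

/-- The gain of the unit bets in the stages tends to one. -/
lemma tendsto_stageGain {K γ : ℝ} (hδ : 0 < δ) (hγ0 : 0 < γ) (hγ : 1 + 2 * θ < 4 * γ)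
    (hK : 0 ≤ K) (hx : ∀ u ∈ Icc (T - δ) T, ∀ v ∈ Icc (T - δ) T, |x v - x u| ≤ K * |v - u| ^ γ)
    (hosc : ∀ᶠ n : ℕ in atTop, ∃ v ∈ Icc (gridPt T δ (2 ^ n)) (gridPt T δ (2 ^ (n + 1))),
      2 * hitLevel θ n < |x v - x (gridPt T δ (2 ^ n))|) :
    Tendsto (stageGain T δ θ x) atTop (𝓝 1) := by
  set C := K * δ ^ γ with hC
  have hC0 : 0 ≤ C := by positivity
  set w : ℕ → ℝ := fun n => C * ((2 : ℝ) ^ n) ^ (-2 * γ) with hw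
  have hw0 : ∀ n, 0 ≤ w n := fun n => by positivity
  have hclose : ∀ n, ∀ u ∈ Icc (T - δ) T, ∀ v ∈ Icc (T - δ) T,
      |v - u| ≤ δ * ((2 : ℝ) ^ n) ^ (-2 : ℝ) → |x v - x u| ≤ w n := by
    intro n u hu v hv huv
    refine (hx u hu v hv).trans ?_
    calc K * |v - u| ^ γ ≤ K * (δ * ((2 : ℝ) ^ n) ^ (-2 : ℝ)) ^ γ := by gcongr
      _ = w n := by
        rw [Real.mul_rpow hδ.le (by positivity), ← Real.rpow_mul (by positivity), ← mul_assoc]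
  have hratio : ∀ n, w n / hitLevel θ n = C * ((2 : ℝ) ^ n) ^ (θ - 2 * γ) := by
    intro n
    rw [hitLevel, Real.rpow_neg (by positivity), div_inv_eq_mul, hw]
    simp only
    rw [mul_assoc, ← Real.rpow_add (by positivity)]
    ring_nf
  have ht0 : Tendsto (fun n => w n / hitLevel θ n) atTop (𝓝 0) := by
    simp only [hratio]
    simpa using (tendsto_two_pow_rpow (e := θ - 2 * γ) (by linarith)).const_mul C
  -- The `2 ^ n` squared increments, relative to the squared level, have exponent `1 + 2 * θ - 4 *
  -- γ`; this is where that hypothesis enters.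
  have hbd : Tendsto (fun n : ℕ => 2 * (w n / hitLevel θ n) +
      (1 + 2 ^ n) * (w n / hitLevel θ n) ^ 2) atTop (𝓝 0) := by
    have e : ∀ n : ℕ, 2 * (w n / hitLevel θ n) + (1 + 2 ^ n) * (w n / hitLevel θ n) ^ 2
        = 2 * (w n / hitLevel θ n) + ((w n / hitLevel θ n) ^ 2 +
          C ^ 2 * ((2 : ℝ) ^ n) ^ (1 + 2 * θ - 4 * γ)) := by
      intro n
      have : ((2 : ℝ) ^ n) ^ (1 + 2 * θ - 4 * γ)
          = 2 ^ n * (((2 : ℝ) ^ n) ^ (θ - 2 * γ)) ^ 2 := by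
        rw [← Real.rpow_natCast (((2 : ℝ) ^ n) ^ (θ - 2 * γ)), ← Real.rpow_mul (by positivity),
          show 1 + 2 * θ - 4 * γ = 1 + (θ - 2 * γ) * (2 : ℕ) by push_cast; ring,
          Real.rpow_add (by positivity), Real.rpow_one]
      rw [this, hratio]
      ring
    simp only [e]
    have h3 := (tendsto_two_pow_rpow (e := 1 + 2 * θ - 4 * γ) (by linarith)).const_mul (C ^ 2)
    simpa using (ht0.const_mul 2).add ((ht0.pow 2).add h3)
  rw [tendsto_iff_norm_sub_tendsto_zero]
  refine squeeze_zero' (Eventually.of_forall fun _ => norm_nonneg _) ?_ hbd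
  filter_upwards [hosc, ht0.eventually_lt_const one_pos] with n hn hn1
  refine abs_stageGain_sub_one_le (hw0 n) (fun k hk => ?_) ?_
  · rw [Finset.mem_Ico] at hk
    have hk1 : 1 ≤ k := Nat.one_le_two_pow.trans hk.1
    refine hclose n _ (gridPt_mem hδ.le hk1) _ (gridPt_mem hδ.le (by omega)) ?_
    rw [abs_of_nonneg (sub_nonneg.2 (gridPt_mono hδ.le hk1 k.le_succ))]
    exact gridPt_succ_sub_le hδ.le hk.1
  -- The path exceeds twice the level at some real time `v`; moving to a nearby grid point costs at
  -- most `w n`, which is below the level, so the level itself is reached on the grid.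
  · obtain ⟨v, hv, hvx⟩ := hn
    obtain ⟨j, hj, hvj⟩ := exists_gridPt_near hδ hv
    refine ⟨j, hj, ?_⟩
    have hb := gridPt_mem (T := T) hδ.le (Nat.one_le_two_pow (n := n))
    have hb' := gridPt_mem (T := T) hδ.le (Nat.one_le_two_pow (n := n + 1))
    have h1 := hclose n _ (gridPt_mem hδ.le (Nat.one_le_two_pow.trans (Finset.mem_Icc.1 hj).1)) v
      ⟨hb.1.trans hv.1, hv.2.trans hb'.2⟩ hvj
    rw [div_lt_one (hitLevel_pos θ n)] at hn1
    have h2 : |x v - x (gridPt T δ (2 ^ n))| ≤ |x v - x (gridPt T δ j)|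
        + |x (gridPt T δ j) - x (gridPt T δ (2 ^ n))| := abs_sub_le _ _ _
    linarith

/-- Once the recursion holds, the bound `max (e N) (2 * C)` reproduces itself. -/
lemma exists_bound_of_recursion {e : ℕ → ℝ} {C : ℝ}
    (h : ∀ᶠ n in atTop, e (n + 1) ≤ 1 / 2 * e n + C) : ∃ B, ∀ n, e n ≤ B := by
  obtain ⟨N, hN⟩ := eventually_atTop.1 h
  have h1 : ∀ n ≥ N, e n ≤ max (e N) (2 * C) := by
    intro n hn
    induction n, hn using Nat.le_induction with
    | base => exact le_max_left _ _
    | succ n hn ih =>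
      have h2 := hN n hn
      have h3 := le_max_right (e N) (2 * C)
      linarith
  have h4 : BddAbove (e '' Iio N) := ((Set.finite_Iio N).image e).bddAbove
  obtain ⟨B, hB⟩ := h4
  refine ⟨max B (max (e N) (2 * C)), fun n => ?_⟩
  rcases lt_or_ge n N with hn | hn
  · exact (hB ⟨n, hn, rfl⟩).trans (le_max_left _ _)
  · exact (h1 n hn).trans (le_max_right _ _)

lemma gridPt_pow_succ_sub (n : ℕ) :
    gridPt T δ (2 ^ (n + 1)) - gridPt T δ (2 ^ n) = δ / 2 * ((2 : ℝ) ^ n)⁻¹ := by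
  unfold gridPt
  push_cast
  field_simp
  ring

/-- After scaling by `2 ^ (na)` the old error is multiplied by `|1 - gain| * 2 ^ a`, eventually at
most `1/2`, while the increment of `z` contributes a constant. -/
lemma exists_stageErr_le {K a : ℝ} (hδ : 0 < δ)
    (hz : ∀ u ∈ Icc (T - δ) T, ∀ v ∈ Icc (T - δ) T, |z v - z u| ≤ K * |v - u| ^ a)
    (hgain : Tendsto (stageGain T δ θ x) atTop (𝓝 1)) :
    ∃ B, 0 ≤ B ∧ ∀ n, |stageErr T δ θ x z n| ≤ B * ((2 : ℝ) ^ n) ^ (-a) := by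
  set y : ℕ → ℝ := fun n => (2 : ℝ) ^ n with hy
  have hy0 : ∀ n, 0 < y n := fun n => by positivity
  set C := K * (δ / 2) ^ a * 2 ^ a with hC
  have hrec : ∀ᶠ n in atTop, |stageErr T δ θ x z (n + 1)| * y (n + 1) ^ a
      ≤ 1 / 2 * (|stageErr T δ θ x z n| * y n ^ a) + C := by
    have h1 : Tendsto (fun n => |1 - stageGain T δ θ x n| * 2 ^ a) atTop (𝓝 0) := by
      have := ((hgain.const_sub 1).abs).mul_const ((2 : ℝ) ^ a)
      simpa using this
    filter_upwards [h1.eventually_le_const (show (0 : ℝ) < 1 / 2 by norm_num)] with n hn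
    have hys : y (n + 1) ^ a = y n ^ a * 2 ^ a := by
      rw [← Real.mul_rpow (hy0 n).le (by norm_num)]
      simp only [hy, pow_succ]
    have hzi : |z (gridPt T δ (2 ^ (n + 1))) - z (gridPt T δ (2 ^ n))|
        ≤ K * (δ / 2) ^ a * (y n ^ a)⁻¹ := by
      refine (hz _ (gridPt_mem hδ.le Nat.one_le_two_pow) _
        (gridPt_mem hδ.le Nat.one_le_two_pow)).trans (le_of_eq ?_)
      have := hy0 n
      rw [gridPt_pow_succ_sub, abs_of_pos (by positivity),
        Real.mul_rpow (by positivity) (by positivity), Real.inv_rpow (by positivity), mul_assoc]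
    have hya : 0 < y n ^ a := Real.rpow_pos_of_pos (hy0 n) a
    calc _ ≤ (|1 - stageGain T δ θ x n| * |stageErr T δ θ x z n|
            + K * (δ / 2) ^ a * (y n ^ a)⁻¹) * (y n ^ a * 2 ^ a) := by
          rw [hys, stageErr]
          gcongr
          refine (abs_add_le _ _).trans ?_
          rw [abs_mul]
          gcongr
      _ = (|1 - stageGain T δ θ x n| * 2 ^ a) * (|stageErr T δ θ x z n| * y n ^ a) + C := by
          rw [hC]
          field_simp
      _ ≤ _ := by gcongr
  obtain ⟨B, hB⟩ := exists_bound_of_recursion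
    (e := fun n => |stageErr T δ θ x z n| * y n ^ a) hrec
  have hB0 : 0 ≤ B := le_trans (by have := hy0 0; positivity) (hB 0)
  refine ⟨B, hB0, fun n => ?_⟩
  rw [Real.rpow_neg (hy0 n).le, ← div_eq_mul_inv, le_div_iff₀ (Real.rpow_pos_of_pos (hy0 n) a)]
  exact hB n

lemma abs_unitBet_le {k : ℕ} (hk : 1 ≤ k) :
    |unitBet T δ θ x k| ≤ 2 * ((2 : ℝ) ^ Nat.log 2 k) ^ θ := by
  have hpos := hitLevel_pos θ (Nat.log 2 k)
  have e : 2 * ((2 : ℝ) ^ Nat.log 2 k) ^ θ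
      = 2 * hitLevel θ (Nat.log 2 k) / hitLevel θ (Nat.log 2 k) ^ 2 := by
    rw [hitLevel, Real.rpow_neg (by positivity)]
    field_simp
  rw [unitBet]
  split_ifs with h
  · rw [e, abs_div, abs_mul, abs_two, abs_of_pos (pow_pos hpos 2), stageDev]
    gcongr
    exact (h k (Finset.mem_Icc.2 ⟨Nat.pow_log_le_self 2 (by omega), le_rfl⟩)).le
  · rw [abs_zero]; positivity

/-- The `m`-th term is `O(m ^ (θ - a - 2(1 - β)))`, and the condition on `β` says that this exponent
is below `-1`. -/
lemma summable_bet {a β B : ℝ} (hδ : 0 < δ) (hβ : β < 1) (hβ2 : 2 * β < 1 + a - θ)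
    (hB0 : 0 ≤ B) (hB : ∀ n, |stageErr T δ θ x z n| ≤ B * ((2 : ℝ) ^ n) ^ (-a)) :
    Summable fun k : ℕ => |bet T δ θ x z (k + 1)| *
      (gridPt T δ (k + 2) - gridPt T δ (k + 1)) ^ (1 - β) := by
  set e := θ - a with he
  have hs : Summable fun k : ℕ => (2 * B * 2 ^ |e| * δ ^ (1 - β)) *
      ((k + 1 : ℕ) : ℝ) ^ (e - 2 * (1 - β)) :=
    ((summable_nat_add_iff 1).2 (Real.summable_nat_rpow.2 (by rw [he]; linarith))).mul_left _
  refine Summable.of_nonneg_of_le (fun k => ?_) (fun k => ?_) hs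
  · have := sub_nonneg.2 (gridPt_mono (T := T) hδ.le (show 1 ≤ k + 1 by omega)
      (show k + 1 ≤ k + 2 by omega))
    positivity
  set m := k + 1 with hm
  have hm1 : 1 ≤ m := by omega
  have hm0 : (0 : ℝ) < m := by exact_mod_cast hm1
  set y : ℝ := (2 : ℝ) ^ Nat.log 2 m with hy
  have hy0 : 0 < y := by positivity
  have hym : y ≤ m := by
    rw [hy]; exact_mod_cast Nat.pow_log_le_self 2 (by omega)
  have hmy : (m : ℝ) ≤ 2 * y := by
    have := (Nat.lt_pow_succ_log_self one_lt_two m).le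
    rw [pow_succ] at this
    rw [hy]
    have h2 : (m : ℝ) ≤ 2 ^ Nat.log 2 m * 2 := by exact_mod_cast this
    linarith
  -- Since `y ≤ m ≤ 2y`, passing from `y` to `m` costs at most `2 ^ |e|`, whatever the sign of `e`.
  have hye : y ^ e ≤ 2 ^ |e| * (m : ℝ) ^ e := by
    have h1 : y ^ e = (m : ℝ) ^ e * (m / y) ^ (-e) := by
      rw [Real.div_rpow hm0.le hy0.le, Real.rpow_neg hm0.le, Real.rpow_neg hy0.le]
      have := Real.rpow_pos_of_pos hm0 e
      field_simp
    rw [h1, mul_comm]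
    gcongr
    have h2 : 1 ≤ m / y := by rwa [one_le_div hy0]
    calc (m / y) ^ (-e) ≤ (m / y) ^ |e| := by
          apply Real.rpow_le_rpow_of_exponent_le h2 (neg_le_abs e)
      _ ≤ 2 ^ |e| := by
          gcongr
          rwa [div_le_iff₀ hy0]
  have hbet : |bet T δ θ x z m| ≤ 2 * B * y ^ e := by
    rw [bet, abs_mul]
    calc _ ≤ (B * y ^ (-a)) * (2 * y ^ θ) := by
          gcongr
          · exact hB _
          · exact abs_unitBet_le hm1
      _ = 2 * B * y ^ e := by
          rw [he, sub_eq_add_neg, Real.rpow_add hy0]; ring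
  have hstep0 : 0 ≤ gridPt T δ (m + 1) - gridPt T δ m :=
    sub_nonneg.2 (gridPt_mono hδ.le hm1 m.le_succ)
  have hstep : gridPt T δ (m + 1) - gridPt T δ m ≤ δ * (m : ℝ) ^ (-2 : ℝ) := by
    rw [gridPt_succ_sub hm1, Real.rpow_neg hm0.le, ← div_eq_mul_inv]
    norm_cast
    push_cast
    gcongr
    nlinarith
  calc |bet T δ θ x z m| * (gridPt T δ (m + 1) - gridPt T δ m) ^ (1 - β)
      ≤ (2 * B * (2 ^ |e| * (m : ℝ) ^ e)) * (δ * (m : ℝ) ^ (-2 : ℝ)) ^ (1 - β) := by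
        have : 0 ≤ 1 - β := by linarith
        gcongr
        exact hbet.trans (by gcongr)
    _ = _ := by
        rw [Real.mul_rpow hδ.le (by positivity), ← Real.rpow_mul hm0.le,
          sub_eq_add_neg e, Real.rpow_add hm0]
        ring_nf

end Strategy

/-! ### Hölder continuity from dyadic increments -/

section Chaining

/-- The dyadic point of level `n` to the left of `t`. -/
def dyadicFloor (n : ℕ) (t : ℝ) : ℝ := (⌊2 ^ n * t⌋₊ : ℝ) / 2 ^ n

lemma dyadicFloor_le {n : ℕ} {t : ℝ} (ht : 0 ≤ t) : dyadicFloor n t ≤ t := by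
  rw [dyadicFloor, div_le_iff₀ (by positivity), mul_comm]
  exact Nat.floor_le (by positivity)

lemma tendsto_dyadicFloor {t : ℝ} (ht : 0 ≤ t) :
    Tendsto (fun n => dyadicFloor n t) atTop (𝓝 t) := by
  have h : Tendsto (fun n : ℕ => t - ((1 : ℝ) / 2) ^ n) atTop (𝓝 (t - 0)) :=
    (tendsto_pow_atTop_nhds_zero_of_lt_one (by norm_num) (by norm_num)).const_sub t
  rw [sub_zero] at h
  refine tendsto_of_tendsto_of_tendsto_of_le_of_le h tendsto_const_nhds (fun n => ?_)
    fun n => dyadicFloor_le ht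
  have hp : (0 : ℝ) < 2 ^ n := by positivity
  have := (Nat.lt_floor_add_one (2 ^ n * t)).le
  simp only [dyadicFloor]
  rw [le_div_iff₀ hp, sub_mul, one_div, inv_pow, inv_mul_cancel₀ hp.ne']
  linarith

/-- A continuous function whose dyadic increments satisfy a Hölder bound from some level on is
Hölder continuous. -/
lemma exists_holder_of_dyadic_unit {f : ℝ → ℝ} {γ : ℝ} (hγ : 0 < γ) (hf : ContinuousOn f (Icc 0 1))
    {N : ℕ} (hN : ∀ n ≥ N, ∀ k : ℕ, k < 2 ^ n →
      |f (((k : ℝ) + 1) / 2 ^ n) - f ((k : ℝ) / 2 ^ n)| ≤ ((2 : ℝ) ^ (-γ)) ^ n) :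
    ∃ K, 0 ≤ K ∧ ∀ u ∈ Icc (0 : ℝ) 1, ∀ v ∈ Icc (0 : ℝ) 1, |f v - f u| ≤ K * |v - u| ^ γ := by
  set r := (2 : ℝ) ^ (-γ) with hr
  have hr0 : 0 < r := by positivity
  have hr1 : r < 1 := Real.rpow_lt_one_of_one_lt_of_neg one_lt_two (by linarith)
  have hstep : ∀ n ≥ N, ∀ i j : ℕ, i ≤ j → j ≤ i + 1 → j ≤ 2 ^ n →
      |f ((j : ℝ) / 2 ^ n) - f ((i : ℝ) / 2 ^ n)| ≤ r ^ n := by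
    intro n hn i j hij hji hj
    rcases eq_or_lt_of_le hij with rfl | hlt
    · simp; positivity
    · obtain rfl : j = i + 1 := by omega
      have := hN n hn i (by omega)
      push_cast
      exact this
  have hfl : ∀ n : ℕ, ∀ t ∈ Icc (0 : ℝ) 1, ⌊2 ^ n * t⌋₊ ≤ 2 ^ n := by
    intro n t ht
    refine Nat.floor_le_of_le ?_
    push_cast
    nlinarith [ht.2, show (0 : ℝ) < 2 ^ n by positivity]
  have hq : ∀ n ≥ N, ∀ t ∈ Icc (0 : ℝ) 1, |f (dyadicFloor (n + 1) t) - f (dyadicFloor n t)|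
      ≤ r ^ (n + 1) := by
    intro n hn t ht
    have hb : 0 ≤ 2 ^ n * t := mul_nonneg (by positivity) ht.1
    have e2 : (2 : ℝ) ^ (n + 1) * t = 2 * (2 ^ n * t) := by rw [pow_succ]; ring
    have e : dyadicFloor n t = ((2 * ⌊2 ^ n * t⌋₊ : ℕ) : ℝ) / 2 ^ (n + 1) := by
      rw [dyadicFloor, pow_succ]; push_cast; field_simp
    rw [e]
    refine hstep (n + 1) (by omega) _ _ ?_ ?_ (hfl _ t ht)
    · rw [e2]
      refine Nat.le_floor ?_
      push_cast
      linarith [Nat.floor_le hb]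
    · rw [e2]
      have h1 := Nat.lt_floor_add_one (2 ^ n * t)
      have : ⌊2 * (2 ^ n * t)⌋₊ < 2 * ⌊2 ^ n * t⌋₊ + 2 := by
        rw [Nat.floor_lt (by positivity)]
        push_cast
        linarith
      omega
  have hdy : ∀ n : ℕ, ∀ t ∈ Icc (0 : ℝ) 1, dyadicFloor n t ∈ Icc (0 : ℝ) 1 := fun n t ht =>
    ⟨by unfold dyadicFloor; positivity, (dyadicFloor_le ht.1).trans ht.2⟩
  -- Telescoping over the levels gives a geometric series; continuity of `f` identifies its limit.
  have happ : ∀ n ≥ N, ∀ t ∈ Icc (0 : ℝ) 1, |f (dyadicFloor n t) - f t| ≤ r ^ n / (1 - r) := by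
    intro n hn t ht
    have hlim : Tendsto (fun j => f (dyadicFloor (j + n) t)) atTop (𝓝 (f t)) := by
      have h1 : Tendsto (fun j => dyadicFloor j t) atTop (𝓝[Icc 0 1] t) :=
        tendsto_nhdsWithin_iff.2 ⟨tendsto_dyadicFloor ht.1, Eventually.of_forall fun j => hdy j t ht⟩
      exact ((hf t ht).tendsto.comp h1).comp (tendsto_add_atTop_nat n)
    have := dist_le_of_le_geometric_of_tendsto₀ r (r ^ n) hr1 (fun j => ?_) hlim
    · rwa [zero_add, Real.dist_eq] at this
    · rw [dist_comm, Real.dist_eq, show j + 1 + n = (j + n) + 1 by ring]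
      refine (hq (j + n) (by omega) t ht).trans ?_
      rw [← pow_add]
      exact pow_le_pow_of_le_one hr0.le hr1.le (by omega)
  obtain ⟨M, hM⟩ := isCompact_Icc.exists_bound_of_continuousOn hf
  have hM0 : 0 ≤ M := (norm_nonneg _).trans (hM 0 (by simp))
  set K₀ := 1 + 2 / (1 - r) with hK₀
  have h1r : 0 < 1 - r := by linarith
  have hK₀0 : 0 ≤ K₀ := by positivity
  -- Points at distance at most `2 ^ (-n)` have equal or adjacent dyadic floors of level `n`; `K₀`
  -- adds that one step to the two chaining tails.
  have hnear : ∀ n ≥ N, ∀ s ∈ Icc (0 : ℝ) 1, ∀ t ∈ Icc (0 : ℝ) 1, s ≤ t → t - s ≤ (1 / 2) ^ n →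
      |f t - f s| ≤ K₀ * r ^ n := by
    intro n hn s hs t ht hst hd
    have hp : (0 : ℝ) < 2 ^ n := by positivity
    have h1 : |f (dyadicFloor n t) - f (dyadicFloor n s)| ≤ r ^ n := by
      refine hstep n hn _ _ (Nat.floor_le_floor (by gcongr)) ?_ (hfl n t ht)
      have h2 : 2 ^ n * t ≤ 2 ^ n * s + 1 := by
        rw [one_div, inv_pow] at hd
        have : 2 ^ n * (t - s) ≤ 1 := by
          calc 2 ^ n * (t - s) ≤ 2 ^ n * ((2 : ℝ) ^ n)⁻¹ := by gcongr
            _ = 1 := mul_inv_cancel₀ hp.ne'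
        linarith
      calc ⌊2 ^ n * t⌋₊ ≤ ⌊2 ^ n * s + 1⌋₊ := Nat.floor_le_floor h2
        _ = ⌊2 ^ n * s⌋₊ + 1 := Nat.floor_add_one (mul_nonneg hp.le hs.1)
    have h2 := happ n hn s hs
    have h3 := happ n hn t ht
    rw [abs_sub_comm] at h3
    have h4 := abs_sub_le (f t) (f (dyadicFloor n t)) (f s)
    have h5 := abs_sub_le (f (dyadicFloor n t)) (f (dyadicFloor n s)) (f s)
    have : K₀ * r ^ n = r ^ n + (r ^ n / (1 - r) + r ^ n / (1 - r)) := by rw [hK₀]; ring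
    linarith
  -- The first term serves close pairs; the second uses the bound `M` of `f` for pairs too far apart
  -- for level `N`.
  set K := K₀ * 2 ^ γ + 2 * M * (2 ^ N) ^ γ with hK
  have hmain : ∀ s ∈ Icc (0 : ℝ) 1, ∀ t ∈ Icc (0 : ℝ) 1, s ≤ t → |f t - f s| ≤ K * |t - s| ^ γ := by
    intro s hs t ht hst
    rcases eq_or_lt_of_le hst with rfl | hlt
    · simp [Real.zero_rpow hγ.ne']
    have hd : 0 < t - s := by linarith
    rw [abs_of_pos hd]
    have hdg : 0 ≤ (t - s) ^ γ := Real.rpow_nonneg hd.le _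
    obtain ⟨n, hn1, hn2⟩ := exists_nat_pow_near_of_lt_one hd (by linarith [ht.2, hs.1])
      (show (0 : ℝ) < 1 / 2 by norm_num) (by norm_num)
    rcases le_or_gt N n with hNn | hNn
    · have h1 := hnear n hNn s hs t ht hst hn2
      have h2 : r ^ n ≤ 2 ^ γ * (t - s) ^ γ := by
        have e : r ^ n = ((1 / 2 : ℝ) ^ n) ^ γ := by
          rw [hr, ← Real.rpow_natCast, ← Real.rpow_natCast, ← Real.rpow_mul (by norm_num),
            ← Real.rpow_mul (by norm_num), one_div, Real.inv_rpow (by norm_num),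
            ← Real.rpow_neg (by norm_num)]
          ring_nf
        rw [e, ← Real.mul_rpow (by norm_num) hd.le]
        gcongr
        rw [pow_succ] at hn1
        linarith
      calc _ ≤ K₀ * r ^ n := h1
        _ ≤ K₀ * (2 ^ γ * (t - s) ^ γ) := by gcongr
        _ ≤ _ := by
          rw [hK, add_mul, ← mul_assoc]
          have : 0 ≤ 2 * M * (2 ^ N) ^ γ * (t - s) ^ γ := by positivity
          linarith
    · have h1 : |f t - f s| ≤ 2 * M := by
        have a1 := hM s hs
        have a2 := hM t ht
        rw [Real.norm_eq_abs] at a1 a2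
        have := abs_sub (f t) (f s)
        linarith
      have h2 : 1 ≤ (2 ^ N) ^ γ * (t - s) ^ γ := by
        rw [← Real.mul_rpow (by positivity) hd.le]
        refine Real.one_le_rpow ?_ hγ.le
        have : ((1 : ℝ) / 2) ^ N ≤ (1 / 2) ^ (n + 1) :=
          pow_le_pow_of_le_one (by norm_num) (by norm_num) hNn
        have h3 : ((1 : ℝ) / 2) ^ N ≤ t - s := this.trans hn1.le
        rw [one_div, inv_pow, inv_le_iff_one_le_mul₀' (by positivity)] at h3
        exact h3
      calc _ ≤ 2 * M * 1 := by linarith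
        _ ≤ 2 * M * ((2 ^ N) ^ γ * (t - s) ^ γ) := by gcongr
        _ ≤ _ := by
          rw [hK, add_mul, ← mul_assoc]
          have : 0 ≤ K₀ * 2 ^ γ * (t - s) ^ γ := by positivity
          linarith
  refine ⟨K, by positivity, fun u hu v hv => ?_⟩
  rcases le_total u v with h | h
  · exact hmain u hu v hv h
  · rw [abs_sub_comm, abs_sub_comm v u]
    exact hmain v hv u hu h

lemma exists_holder_of_dyadic {f : ℝ → ℝ} {γ A δ : ℝ} (hγ : 0 < γ) (hδ : 0 < δ)
    (hf : ContinuousOn f (Icc A (A + δ))) {N : ℕ} (hN : ∀ n ≥ N, ∀ k : ℕ, k < 2 ^ n →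
      |f (A + δ * (((k : ℝ) + 1) / 2 ^ n)) - f (A + δ * ((k : ℝ) / 2 ^ n))|
        ≤ ((2 : ℝ) ^ (-γ)) ^ n) :
    ∃ K, 0 ≤ K ∧ ∀ u ∈ Icc A (A + δ), ∀ v ∈ Icc A (A + δ), |f v - f u| ≤ K * |v - u| ^ γ := by
  obtain ⟨K, hK0, hK⟩ := exists_holder_of_dyadic_unit (f := fun t => f (A + δ * t)) hγ
    (hf.comp (by fun_prop) fun t ht => ⟨by nlinarith [ht.1], by nlinarith [ht.2]⟩) hN
  refine ⟨K * (δ⁻¹) ^ γ, by positivity, fun u hu v hv => ?_⟩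
  have hm : ∀ u ∈ Icc A (A + δ), δ⁻¹ * (u - A) ∈ Icc (0 : ℝ) 1 := fun u hu =>
    ⟨mul_nonneg (by positivity) (by linarith [hu.1]),
      by rw [inv_mul_le_iff₀ hδ]; linarith [hu.2]⟩
  have he : ∀ u, A + δ * (δ⁻¹ * (u - A)) = u := fun u => by field_simp; ring
  have := hK _ (hm u hu) _ (hm v hv)
  rw [he, he, ← mul_sub, abs_mul, abs_of_pos (inv_pos.2 hδ), sub_sub_sub_cancel_right,
    Real.mul_rpow (by positivity) (abs_nonneg _)] at this
  rwa [mul_assoc]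

end Chaining

/-! ### Almost sure Hölder continuity and oscillation -/

section BorelCantelli

variable {Ω : Type*} [MeasurableSpace Ω] {μ : Measure Ω}

lemma summable_two_pow_mul_exp {c e : ℝ} (hc : 0 < c) (he : 0 < e) :
    Summable fun n : ℕ => (2 : ℝ) ^ n * Real.exp (-c * ((2 : ℝ) ^ n) ^ e) := by
  refine Summable.of_norm_bounded_eventually_nat (g := fun n : ℕ => ((1 : ℝ) / 2) ^ n)
    (summable_geometric_of_lt_one (by norm_num) (by norm_num)) ?_
  have h1 : Tendsto (fun n : ℕ => ((2 : ℝ) ^ n) ^ e) atTop atTop :=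
    (tendsto_rpow_atTop he).comp (tendsto_pow_atTop_atTop_of_one_lt one_lt_two)
  have h2 := (tendsto_rpow_mul_exp_neg_mul_atTop_nhds_zero (2 / e) c hc).comp h1
  filter_upwards [h2.eventually_le_const one_pos] with n hn
  have hy : (0 : ℝ) < 2 ^ n := by positivity
  simp only [Function.comp] at hn
  rw [← Real.rpow_mul hy.le, mul_div_cancel₀ _ he.ne'] at hn
  rw [Real.norm_of_nonneg (by positivity), one_div, inv_pow]
  norm_cast at hn
  push_cast at hn
  rw [← mul_le_mul_iff_right₀ hy, mul_inv_cancel₀ hy.ne']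
  calc _ = (2 ^ n) ^ 2 * Real.exp (-c * ((2 : ℝ) ^ n) ^ e) := by ring
    _ ≤ 1 := hn

lemma ae_eventually_notMem_of_real_le [IsFiniteMeasure μ] {S : ℕ → Set Ω} {b : ℕ → ℝ}
    (hS : ∀ᶠ n in atTop, μ.real (S n) ≤ b n) (hb : Summable b) :
    ∀ᵐ ω ∂μ, ∀ᶠ n in atTop, ω ∉ S n := by
  refine ae_eventually_notMem ?_
  have hs : Summable fun n => μ.real (S n) :=
    Summable.of_norm_bounded_eventually_nat hb
      (hS.mono fun n hn => by rwa [Real.norm_of_nonneg measureReal_nonneg])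
  have : ∀ n, μ (S n) = ENNReal.ofReal (μ.real (S n)) := fun n => by simp
  simp only [this]
  exact hs.tsum_ofReal_lt_top.ne

/-- Chernoff's bound on both tails; any `v` above the variance is an admissible sub-Gaussian
parameter. -/
lemma measureReal_abs_ge_le_of_hasGaussianLaw [IsProbabilityMeasure μ] {Y : Ω → ℝ}
    (hY : HasGaussianLaw Y μ) (h0 : ∫ ω, Y ω ∂μ = 0) {v r : ℝ} (hv : ∫ ω, Y ω ^ 2 ∂μ ≤ v)
    (hv0 : 0 ≤ v) (hr : 0 ≤ r) :
    μ.real {ω | r ≤ |Y ω|} ≤ 2 * Real.exp (-r ^ 2 / (2 * v)) := by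
  have hmap := hY.map_eq_gaussianReal
  have hmgf := fun t => mgf_gaussianReal hmap t
  have hvar : Var[Y; μ] ≤ v := by rwa [variance_of_integral_eq_zero hY.aemeasurable h0]
  have hsub : HasSubgaussianMGF Y ⟨v, hv0⟩ μ := by
    constructor
    · intro t
      rw [← mgf_pos_iff, hmgf]
      exact Real.exp_pos _
    · intro t
      rw [hmgf, h0, zero_mul, zero_add, Real.coe_toNNReal _ (variance_nonneg _ _)]
      change _ ≤ Real.exp (v * t ^ 2 / 2)
      gcongr
  have h1 := hsub.measure_ge_le hr
  have h2 := hsub.neg.measure_ge_le hr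
  calc _ ≤ μ.real ({ω | r ≤ Y ω} ∪ {ω | r ≤ (-Y) ω}) := by
        refine measureReal_mono (fun ω hω => ?_)
        exact le_abs.1 (show r ≤ |Y ω| from hω)
    _ ≤ μ.real {ω | r ≤ Y ω} + μ.real {ω | r ≤ (-Y) ω} := measureReal_union_le _ _
    _ ≤ Real.exp (-r ^ 2 / (2 * v)) + Real.exp (-r ^ 2 / (2 * v)) := add_le_add h1 h2
    _ = _ := by ring

/-- Hölder continuity of the paths of a Gaussian process of order `γ < α` on an interval where
`E[(X_t - X_s)²] ≤ C |t - s|^{2α}`. -/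
theorem ae_exists_holder [IsProbabilityMeasure μ] {X : ℝ → Ω → ℝ} {A δ C α γ : ℝ} (hδ : 0 < δ)
    (hC : 0 < C) (hγ : 0 < γ) (hγα : γ < α)
    (hgauss : ∀ s ∈ Icc A (A + δ), ∀ t ∈ Icc A (A + δ), HasGaussianLaw (fun ω => X t ω - X s ω) μ)
    (hcent : ∀ s ∈ Icc A (A + δ), ∀ t ∈ Icc A (A + δ), ∫ ω, (X t ω - X s ω) ∂μ = 0)
    (hvar : ∀ s ∈ Icc A (A + δ), ∀ t ∈ Icc A (A + δ), s ≤ t → incVar μ X t s ≤ C * (t - s) ^ (2 * α))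
    (hcont : ∀ᵐ ω ∂μ, ContinuousOn (fun t => X t ω) (Icc A (A + δ))) :
    ∀ᵐ ω ∂μ, ∃ K, 0 ≤ K ∧ ∀ u ∈ Icc A (A + δ), ∀ v ∈ Icc A (A + δ),
      |X v ω - X u ω| ≤ K * |v - u| ^ γ := by
  set d : ℕ → ℕ → ℝ := fun n k => A + δ * ((k : ℝ) / 2 ^ n) with hd
  set S : ℕ → Set Ω := fun n => ⋃ k ∈ Finset.range (2 ^ n),
    {ω | ((2 : ℝ) ^ (-γ)) ^ n ≤ |X (d n (k + 1)) ω - X (d n k) ω|} with hS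
  have hdm : ∀ n k, k ≤ 2 ^ n → d n k ∈ Icc A (A + δ) := by
    intro n k hk
    have h1 : (k : ℝ) / 2 ^ n ≤ 1 := by
      rw [div_le_one (by positivity)]
      exact_mod_cast hk
    have h2 : (0 : ℝ) ≤ (k : ℝ) / 2 ^ n := by positivity
    exact ⟨by simp only [hd]; nlinarith, by simp only [hd]; nlinarith⟩
  -- With variance at most `C (δ 2 ^ (-n)) ^ (2α)` and threshold `2 ^ (-γn)`, the Gaussian exponent
  -- is `c (2 ^ n) ^ (2(α - γ))`.
  set c := (2 * (C * δ ^ (2 * α)))⁻¹ with hc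
  have hc0 : 0 < c := by positivity
  have hprob : ∀ n, μ.real (S n) ≤
      2 * ((2 : ℝ) ^ n * Real.exp (-c * ((2 : ℝ) ^ n) ^ (2 * (α - γ)))) := by
    intro n
    have hy : (0 : ℝ) < 2 ^ n := by positivity
    calc μ.real (S n) ≤ ∑ k ∈ Finset.range (2 ^ n),
          μ.real {ω | ((2 : ℝ) ^ (-γ)) ^ n ≤ |X (d n (k + 1)) ω - X (d n k) ω|} :=
          measureReal_biUnion_finset_le _ _
      _ ≤ ∑ k ∈ Finset.range (2 ^ n), 2 * Real.exp (-c * ((2 : ℝ) ^ n) ^ (2 * (α - γ))) := by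
          refine Finset.sum_le_sum fun k hk => ?_
          rw [Finset.mem_range] at hk
          have m1 := hdm n k hk.le
          have m2 := hdm n (k + 1) hk
          have hdd : d n (k + 1) - d n k = δ * ((2 : ℝ) ^ n)⁻¹ := by
            simp only [hd]; push_cast; field_simp; ring
          have hv := hvar _ m1 _ m2 (by
            rw [← sub_nonneg, hdd]; positivity)
          rw [hdd] at hv
          refine (measureReal_abs_ge_le_of_hasGaussianLaw (hgauss _ m1 _ m2) (hcent _ m1 _ m2)
            hv (by positivity) (by positivity)).trans (le_of_eq ?_)
          congr 2
          rw [Real.mul_rpow hδ.le (by positivity), hc, ← Real.rpow_natCast (_ ^ n) 2,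
            ← Real.rpow_natCast _ n, ← Real.rpow_mul (by positivity), ← Real.rpow_mul (by positivity),
            ← Real.rpow_natCast 2 n, ← Real.rpow_neg (by positivity), ← Real.rpow_mul (by positivity),
            ← Real.rpow_mul (by positivity), show (n : ℝ) * (2 * (α - γ))
              = -γ * n * ((2 : ℕ) : ℝ) - (-(n : ℝ)) * (2 * α) by push_cast; ring,
            Real.rpow_sub (by positivity)]
          field_simp
      _ = _ := by
          rw [Finset.sum_const, Finset.card_range, nsmul_eq_mul]
          push_cast
          ring
  have hbc := ae_eventually_notMem_of_real_le (Eventually.of_forall hprob)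
    ((summable_two_pow_mul_exp hc0 (show 0 < 2 * (α - γ) by linarith)).mul_left 2)
  filter_upwards [hbc, hcont] with ω hω hcω
  obtain ⟨N, hN⟩ := eventually_atTop.1 hω
  refine exists_holder_of_dyadic (f := fun t => X t ω) hγ hδ hcω (N := N) fun n hn k hk => ?_
  have := hN n hn
  simp only [hS, mem_iUnion, not_exists, Finset.mem_range, mem_ofPred_eq, not_le] at this
  have := (this k hk).le
  simp only [hd] at this
  push_cast at this
  exact this

/-- Borel–Cantelli for the small ball estimate: the oscillation of the path exceeds twice the
hitting level in all but finitely many stages. -/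
theorem ae_eventually_osc [IsProbabilityMeasure μ] {X : ℝ → Ω → ℝ} {T δ Δ C α θ : ℝ} (hδ : 0 < δ)
    (hδΔ : δ ≤ Δ) (hC : 0 < C) (hα : 0 < α) (hαθ : α < θ)
    (hball : ∀ s ∈ Icc (T - δ) T, ∀ t ∈ Icc (T - δ) T,
      s < t → t - s ≤ Δ → ∀ ε, 0 < ε → ε ≤ (t - s) ^ α →
        μ.real {ω | ∀ v ∈ Icc s t, |X v ω - X s ω| ≤ ε}
          ≤ Real.exp (-C * (t - s) * ε ^ (-(1 / α)))) :
    ∀ᵐ ω ∂μ, ∀ᶠ n : ℕ in atTop, ∃ v ∈ Icc (gridPt T δ (2 ^ n)) (gridPt T δ (2 ^ (n + 1))),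
      2 * hitLevel θ n < |X v ω - X (gridPt T δ (2 ^ n)) ω| := by
  set c := C * (δ / 2) * 2 ^ (-(1 / α)) with hc
  have hc0 : 0 < c := by positivity
  have he : 0 < θ / α - 1 := by
    rw [sub_pos, one_lt_div hα]; exact hαθ
  -- The small ball estimate admits only radii up to the length to the power `α`; since `θ > α`, the
  -- doubled level eventually qualifies.
  have hlev : ∀ᶠ n : ℕ in atTop, 2 * hitLevel θ n ≤ (δ / 2 * ((2 : ℝ) ^ n)⁻¹) ^ α := by
    have h1 := (tendsto_two_pow_rpow (e := α - θ) (by linarith)).eventually_le_const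
      (show 0 < (δ / 2) ^ α / 2 by positivity)
    filter_upwards [h1] with n hn
    have hy : (0 : ℝ) < 2 ^ n := by positivity
    rw [Real.mul_rpow (by positivity) (by positivity), Real.inv_rpow hy.le, hitLevel,
      ← div_eq_mul_inv, le_div_iff₀ (Real.rpow_pos_of_pos hy α), mul_assoc,
      ← Real.rpow_add hy, neg_add_eq_sub]
    linarith
  have hbc := ae_eventually_notMem_of_real_le (μ := μ)
    (S := fun n => {ω | ∀ v ∈ Icc (gridPt T δ (2 ^ n)) (gridPt T δ (2 ^ (n + 1))),
      |X v ω - X (gridPt T δ (2 ^ n)) ω| ≤ 2 * hitLevel θ n})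
    (b := fun n => (2 : ℝ) ^ n * Real.exp (-c * ((2 : ℝ) ^ n) ^ (θ / α - 1)))
    ?_ (summable_two_pow_mul_exp hc0 he)
  · filter_upwards [hbc] with ω hω
    filter_upwards [hω] with n hn
    simpa only [mem_ofPred_eq, not_forall, not_le, exists_prop] using hn
  · filter_upwards [hlev] with n hn
    have hy : (0 : ℝ) < 2 ^ n := by positivity
    have hy1 : (1 : ℝ) ≤ 2 ^ n := one_le_pow₀ one_le_two
    have hlen := gridPt_pow_succ_sub (T := T) (δ := δ) n
    have hpos : 0 < δ / 2 * ((2 : ℝ) ^ n)⁻¹ := by positivity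
    have hle : δ / 2 * ((2 : ℝ) ^ n)⁻¹ ≤ Δ := by
      have : ((2 : ℝ) ^ n)⁻¹ ≤ 1 := inv_le_one_of_one_le₀ hy1
      nlinarith
    have := hball _ (gridPt_mem hδ.le (Nat.one_le_two_pow (n := n))) _
      (gridPt_mem hδ.le (Nat.one_le_two_pow (n := n + 1))) (by linarith) (by linarith)
      (2 * hitLevel θ n) (by have := hitLevel_pos θ n; positivity) (by rw [hlen]; exact hn)
    refine this.trans ?_
    have hexp : -C * (gridPt T δ (2 ^ (n + 1)) - gridPt T δ (2 ^ n)) *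
        (2 * hitLevel θ n) ^ (-(1 / α)) = -c * ((2 : ℝ) ^ n) ^ (θ / α - 1) := by
      rw [hlen, hc, hitLevel, Real.mul_rpow (by norm_num) (by positivity), ← Real.rpow_mul hy.le,
        show -θ * -(1 / α) = θ / α by ring, Real.rpow_sub hy, Real.rpow_one]
      field_simp
    rw [hexp]
    -- The factor `2 ^ n ≥ 1` is inserted only to reuse the summability shared with the chaining
    -- argument.
    exact le_mul_of_one_le_left (Real.exp_pos _).le hy1

end BorelCantelli

/-! ### The integral of the strategy along a good path -/

section Pathwise

variable {T δ θ : ℝ}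

/-- The step function that holds the bet of the strategy between consecutive grid points. -/
def strategy (T δ θ : ℝ) (x z : ℝ → ℝ) : ℝ → ℝ :=
  stepFun (fun k => gridPt T δ (k + 1)) fun k => bet T δ θ x z (k + 1)

lemma monotone_gridPt_succ (hδ : 0 ≤ δ) : Monotone fun k => gridPt T δ (k + 1) :=
  fun j k hjk => gridPt_mono hδ (by omega) (by omega)

lemma tendsto_gridPt : Tendsto (gridPt T δ) atTop (𝓝 T) := by
  have : Tendsto (fun k : ℕ => δ / (k : ℝ)) atTop (𝓝 0) :=
    tendsto_const_nhds.div_atTop tendsto_natCast_atTop_atTop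
  have h := this.const_sub T
  rw [sub_zero] at h
  exact h

/-- The integral of the strategy with respect to a Hölder path that oscillates enough in almost all
stages is the terminal value of the target path. -/
theorem hasGLSIntegral_strategy {K γ L a β : ℝ} {x z : ℝ → ℝ} (hδ : 0 < δ) (hδT : δ ≤ T)
    (hx : ContinuousOn x (Icc 0 T)) (hK : 0 ≤ K)
    (hxH : ∀ u ∈ Icc (T - δ) T, ∀ v ∈ Icc (T - δ) T, |x v - x u| ≤ K * |v - u| ^ γ)
    (ha : 0 < a)
    (hz : ∀ u ∈ Icc (T - δ) T, ∀ v ∈ Icc (T - δ) T, |z v - z u| ≤ L * |v - u| ^ a)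
    (hγ : 1 + 2 * θ < 4 * γ) (hβ0 : 0 < β) (hβ : β < 1) (hβγ : 1 - β < γ)
    (hβθ : 2 * β < 1 + a - θ)
    (hosc : ∀ᶠ n : ℕ in atTop, ∃ v ∈ Icc (gridPt T δ (2 ^ n)) (gridPt T δ (2 ^ (n + 1))),
      2 * hitLevel θ n < |x v - x (gridPt T δ (2 ^ n))|) :
    HasGLSIntegral β (strategy T δ θ x z) x T (z T) := by
  have hgain := tendsto_stageGain hδ (by linarith) hγ hK hxH hosc
  obtain ⟨B, hB0, hB⟩ := exists_stageErr_le hδ hz hgain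
  have herr : Tendsto (stageErr T δ θ x z) atTop (𝓝 0) := by
    have h := (tendsto_two_pow_rpow (e := -a) (by linarith)).const_mul B
    rw [mul_zero] at h
    exact squeeze_zero_norm hB h
  have hpow : Tendsto (fun n : ℕ => 2 ^ n) atTop atTop :=
    tendsto_pow_atTop_atTop_of_one_lt one_lt_two
  have hzT : Tendsto (fun n : ℕ => z (gridPt T δ (2 ^ n))) atTop (𝓝 (z T)) := by
    rw [tendsto_iff_norm_sub_tendsto_zero]
    have hT : T ∈ Icc (T - δ) T := ⟨by linarith, le_rfl⟩
    have h : Tendsto (fun n : ℕ => L * |gridPt T δ (2 ^ n) - T| ^ a) atTop (𝓝 (L * |T - T| ^ a)) :=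
      ((((tendsto_gridPt.comp hpow).sub_const T).abs).rpow_const (Or.inr ha.le)).const_mul L
    rw [sub_self, abs_zero, Real.zero_rpow ha.ne', mul_zero] at h
    exact squeeze_zero (fun n => norm_nonneg _)
      (fun n => hz T hT _ (gridPt_mem hδ.le Nat.one_le_two_pow)) h
  -- The wealth is known at stage ends, after the bets `1 ≤ m < 2 ^ n`; steps are indexed from `0`,
  -- hence `2 ^ n - 1` of them.
  refine hasGLSIntegral_stepFun (A := T - δ) (φ := fun n => 2 ^ n - 1) hx hK hxH hβ0 hβ hβγ
    (monotone_gridPt_succ hδ.le) (by linarith) (gridPt_mem hδ.le le_rfl).1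
    (fun k => gridPt_lt hδ (by omega)) (tendsto_gridPt.comp (tendsto_add_atTop_nat 1))
    (summable_bet hδ hβ hβθ hB0 hB) ?_ ?_
  · exact (tendsto_sub_atTop_nat 1).comp hpow
  · have h := hzT.sub herr
    rw [sub_zero] at h
    refine h.congr fun n => ?_
    rw [← sum_bet, Finset.sum_Ico_eq_sum_range]
    refine Finset.sum_congr rfl fun k _ => ?_
    rw [add_comm 1 k]

end Pathwise

/-! ### Adaptedness of the strategy -/

section Measurability

variable {S : Type*} {T δ θ : ℝ} {X Z : ℝ → S → ℝ}

lemma measurable_unitBet [MeasurableSpace S] {k : ℕ} (hk : 1 ≤ k)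
    (hX : ∀ j, 1 ≤ j → j ≤ k → Measurable (X (gridPt T δ j))) :
    Measurable fun ω => unitBet T δ θ (fun t => X t ω) k := by
  have hb : 2 ^ Nat.log 2 k ≤ k := Nat.pow_log_le_self 2 (by omega)
  have h0 := hX _ Nat.one_le_two_pow hb
  have hk' := hX k hk le_rfl
  unfold unitBet stageDev
  refine Measurable.ite ?_ (by fun_prop) measurable_const
  have : {ω | ∀ j ∈ Finset.Icc (2 ^ Nat.log 2 k) k, |X (gridPt T δ j) ω
      - X (gridPt T δ (2 ^ Nat.log 2 k)) ω| < hitLevel θ (Nat.log 2 k)}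
      = ⋂ j ∈ Finset.Icc (2 ^ Nat.log 2 k) k, {ω | |X (gridPt T δ j) ω
      - X (gridPt T δ (2 ^ Nat.log 2 k)) ω| < hitLevel θ (Nat.log 2 k)} := by
    ext ω; simp
  rw [this]
  refine Finset.measurableSet_biInter _ fun j hj => ?_
  rw [Finset.mem_Icc] at hj
  have hj' := hX j (Nat.one_le_two_pow.trans hj.1) hj.2
  exact measurableSet_lt (by fun_prop) measurable_const

lemma measurable_stageGain [MeasurableSpace S] {n : ℕ}
    (hX : ∀ j, 1 ≤ j → j ≤ 2 ^ (n + 1) → Measurable (X (gridPt T δ j))) :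
    Measurable fun ω => stageGain T δ θ (fun t => X t ω) n := by
  unfold stageGain
  refine Finset.measurable_fun_sum _ fun k hk => ?_
  rw [Finset.mem_Ico] at hk
  have hk1 : 1 ≤ k := Nat.one_le_two_pow.trans hk.1
  exact (measurable_unitBet hk1 fun j hj1 hj2 => hX j hj1 (by omega)).mul
    ((hX (k + 1) (by omega) (by omega)).sub (hX k hk1 (by omega)))

lemma measurable_stageErr [MeasurableSpace S] {n : ℕ}
    (hX : ∀ j, 1 ≤ j → j ≤ 2 ^ n → Measurable (X (gridPt T δ j)))
    (hZ : ∀ j, 1 ≤ j → j ≤ 2 ^ n → Measurable (Z (gridPt T δ j))) :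
    Measurable fun ω => stageErr T δ θ (fun t => X t ω) (fun t => Z t ω) n := by
  induction n with
  | zero => simpa [stageErr] using hZ 1 le_rfl (by simp)
  | succ n ih =>
    have hle : 2 ^ n ≤ 2 ^ (n + 1) := Nat.pow_le_pow_right two_pos n.le_succ
    have h1 := ih (fun j hj1 hj2 => hX j hj1 (hj2.trans hle))
      fun j hj1 hj2 => hZ j hj1 (hj2.trans hle)
    have h2 := measurable_stageGain (θ := θ) hX
    have h3 := hZ _ Nat.one_le_two_pow le_rfl
    have h4 := hZ _ Nat.one_le_two_pow hle
    simp only [stageErr]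
    fun_prop

lemma measurable_bet [MeasurableSpace S] {k : ℕ} (hk : 1 ≤ k)
    (hX : ∀ j, 1 ≤ j → j ≤ k → Measurable (X (gridPt T δ j)))
    (hZ : ∀ j, 1 ≤ j → j ≤ k → Measurable (Z (gridPt T δ j))) :
    Measurable fun ω => bet T δ θ (fun t => X t ω) (fun t => Z t ω) k := by
  have hb : 2 ^ Nat.log 2 k ≤ k := Nat.pow_log_le_self 2 (by omega)
  exact (measurable_stageErr (fun j h1 h2 => hX j h1 (h2.trans hb))
    fun j h1 h2 => hZ j h1 (h2.trans hb)).mul (measurable_unitBet hk hX)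

lemma measurable_strategy [MeasurableSpace S] (hδ : 0 < δ) {t : ℝ} (htT : t ≤ T)
    (hX : ∀ s ∈ Icc (T - δ) t, Measurable (X s)) (hZ : ∀ s ∈ Icc (T - δ) t, Measurable (Z s)) :
    Measurable fun ω => strategy T δ θ (fun t => X t ω) (fun t => Z t ω) t := by
  rcases eq_or_lt_of_le htT with rfl | ht
  · have : ∀ ω, strategy t δ θ (fun t => X t ω) (fun t => Z t ω) t = 0 := fun ω => by
      rw [strategy, stepFun, ← tsum_zero]
      congr 1
      ext k
      rw [unitStep_eq_zero_of_lt (gridPt_lt hδ (by omega)), mul_zero]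
    simp only [this]
    exact measurable_const
  · obtain ⟨N, hN⟩ := exists_le_of_lt
      ((tendsto_gridPt (T := T) (δ := δ)).comp (tendsto_add_atTop_nat 1)) ht
    have : ∀ ω, strategy T δ θ (fun t => X t ω) (fun t => Z t ω) t
        = ∑ k ∈ Finset.range N, bet T δ θ (fun t => X t ω) (fun t => Z t ω) (k + 1) *
          unitStep (gridPt T δ (k + 1)) (gridPt T δ (k + 1 + 1)) t := fun ω =>
      stepFun_of_le (monotone_gridPt_succ hδ.le) hN
    simp only [this]
    refine Finset.measurable_fun_sum _ fun k _ => ?_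
    -- Steps are open on the left, so one that has not started strictly before `t` contributes
    -- nothing; every other bet uses only values at grid points before `t`.
    by_cases hk : t ≤ gridPt T δ (k + 1)
    · simp only [unitStep_eq_zero_of_le hk, mul_zero]
      exact measurable_const
    · have hm : ∀ j, 1 ≤ j → j ≤ k + 1 → gridPt T δ j ∈ Icc (T - δ) t := fun j h1 h2 =>
        ⟨(gridPt_mem hδ.le h1).1, (gridPt_mono hδ.le h1 h2).trans (not_le.1 hk).le⟩
      exact (measurable_bet (by omega) (fun j h1 h2 => hX _ (hm j h1 h2))
        fun j h1 h2 => hZ _ (hm j h1 h2)).mul_const _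

end Measurability

/-! ### Path regularity for the class of processes -/

section ClassX

variable {Ω : Type*} [MeasurableSpace Ω] {μ : Measure Ω} {X : ℝ → Ω → ℝ} {α T : ℝ}

lemma ClassX.hasGaussianLaw_sub (hX : ClassX μ X α T) {s t : ℝ} (hs : s ∈ Icc 0 T)
    (ht : t ∈ Icc 0 T) : HasGaussianLaw (fun ω => X t ω - X s ω) μ :=
  hX.gaussian.hasGaussianLaw_fun_sub (s := ⟨t, ht⟩) (t := ⟨s, hs⟩)

lemma ClassX.integral_sub_eq_zero (hX : ClassX μ X α T) {s t : ℝ} (hs : s ∈ Icc 0 T)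
    (ht : t ∈ Icc 0 T) : ∫ ω, (X t ω - X s ω) ∂μ = 0 := by
  rw [integral_sub (hX.gaussian.hasGaussianLaw_eval ⟨t, ht⟩).integrable
    (hX.gaussian.hasGaussianLaw_eval ⟨s, hs⟩).integrable, hX.centered t ht, hX.centered s hs,
    sub_zero]

lemma LocalConditions.exists_incVar_le {u : ℝ} (h : LocalConditions μ (incr X u) α (T - u)) :
    ∃ C > 0, ∀ s ∈ Icc u T, ∀ t ∈ Icc u T, s ≤ t → incVar μ X t s ≤ C * (t - s) ^ (2 * α) := by
  obtain ⟨C, hC, hCle⟩ := h.worst_incVar_le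
  refine ⟨C, hC, fun s hs t ht hst => ?_⟩
  have := hCle (t - s) (s - u) (by linarith) (by linarith [hs.1]) (by linarith [ht.2])
  simpa only [incVar, incr, sub_add_sub_cancel, sub_add_cancel, sub_sub_sub_cancel_right] using this

/-- Rational orders put all exponents on one event of full measure; the order needed later depends
on `β`, while the exceptional set must not. -/
lemma ClassX.ae_holder [IsProbabilityMeasure μ] (hX : ClassX μ X α T) {δ C : ℝ} (hδ : 0 < δ)
    (hδT : δ ≤ T) (hC : 0 < C) (hinc : ∀ s ∈ Icc (T - δ) T, ∀ t ∈ Icc (T - δ) T, s ≤ t →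
      incVar μ X t s ≤ C * (t - s) ^ (2 * α)) :
    ∀ᵐ ω ∂μ, ∀ q : ℚ, 0 < (q : ℝ) → (q : ℝ) < α → ∃ K, 0 ≤ K ∧ ∀ u ∈ Icc (T - δ) T,
      ∀ v ∈ Icc (T - δ) T, |X v ω - X u ω| ≤ K * |v - u| ^ (q : ℝ) := by
  rw [ae_all_iff]
  intro q
  by_cases hq : 0 < (q : ℝ) ∧ (q : ℝ) < α
  · have hsub : Icc (T - δ) T ⊆ Icc 0 T := Icc_subset_Icc_left (by linarith)
    have := ae_exists_holder (μ := μ) (X := X) (A := T - δ) (δ := δ) (C := C) (α := α) (γ := q) hδ hC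
      hq.1 hq.2
    rw [sub_add_cancel] at this
    filter_upwards [this (fun s hs t ht => hX.hasGaussianLaw_sub (hsub hs) (hsub ht))
      (fun s hs t ht => hX.integral_sub_eq_zero (hsub hs) (hsub ht)) hinc
      (hX.continuous.mono fun ω h => h.mono hsub)] with ω hω _ _ using hω
  · exact Eventually.of_forall fun ω h1 h2 => absurd ⟨h1, h2⟩ hq

end ClassX

end GaussRep

end

/-! ### Choice of the parameters and conclusion -/

theorem theorem3p5 {Ω : Type*} [mΩ : MeasurableSpace Ω] (μ : Measure Ω) [IsProbabilityMeasure μ]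
    (T α : ℝ) (hT : 0 < T) (hα : 1 / 2 < α)
    (F : Filtration (Icc (0 : ℝ) T) mΩ)
    (X : ℝ → Ω → ℝ) (hXadapted : Adapted F (fun t : Icc (0 : ℝ) T => X t))
    (hX : GaussRep.ClassX μ X α T) (hball : GaussRep.SmallBall μ X α T)
    (ξ : Ω → ℝ) (hξ : Measurable[F ⟨T, right_mem_Icc.mpr hT.le⟩] ξ)
    (a : ℝ) (ha : 1 - α < a)
    (Z : ℝ → Ω → ℝ) (hZadapted : Adapted F (fun t : Icc (0 : ℝ) T => Z t))
    (hZ : ∀ᵐ ω ∂μ, ∃ K : ℝ, ∀ s ∈ Icc 0 T, ∀ t ∈ Icc 0 T,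
      |Z t ω - Z s ω| ≤ K * |t - s| ^ a)
    (hZT : ∀ᵐ ω ∂μ, Z T ω = ξ ω) :
    ∃ Ψ : ℝ → Ω → ℝ, Adapted F (fun t : Icc (0 : ℝ) T => Ψ t) ∧
      ∃ β₀ > 1 - α, ∀ᵐ ω ∂μ, ∀ β ∈ Ioo (1 - α) β₀,
        GaussRep.HasGLSIntegral β (fun s => Ψ s ω) (fun s => X s ω) T (ξ ω) := by
  have hα1 := hX.alpha_lt_one
  obtain ⟨δ₁, hδ₁, hloc⟩ := hX.increments
  obtain ⟨C', hC', δ₂, hδ₂, Δ, hΔ, hsb⟩ := hball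
  set δ := min δ₁ (min δ₂ Δ) with hδdef
  have hδ : 0 < δ := lt_min hδ₁.1 (lt_min hδ₂.1 hΔ)
  have hδle1 : δ ≤ δ₁ := min_le_left _ _
  have hδle2 : δ ≤ δ₂ := (min_le_right _ _).trans (min_le_left _ _)
  have hδle3 : δ ≤ Δ := (min_le_right _ _).trans (min_le_right _ _)
  have hδT : δ ≤ T := hδle1.trans hδ₁.2
  -- The lower bound forces the oscillation. Below `2 * α - 1 + a`, which exceeds `α` as `a > 1 -
  -- α`, the bound `(1 + a - θ) / 2` on `β` exceeds `1 - α`. Below `2 * α - 1 / 2`, which exceeds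
  -- `α` as `α > 1 / 2`, some `γ < α` satisfies `1 + 2 * θ < 4 * γ`.
  obtain ⟨θ, hθ1, hθ2⟩ : ∃ θ, α < θ ∧ θ < min (2 * α - 1 + a) (2 * α - 1 / 2) :=
    exists_between (lt_min (by linarith) (by linarith))
  have hθa := hθ2.trans_le (min_le_left _ _)
  have hθb := hθ2.trans_le (min_le_right _ _)
  -- The constants may depend on the starting time, so the single time `T - δ` is used; its
  -- condition covers all of `[T - δ, T]`.
  obtain ⟨C, hC, hinc⟩ := (hloc (T - δ) ⟨by linarith, by linarith⟩).exists_incVar_le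
  have hsub : Icc (T - δ) T ⊆ Icc 0 T := Icc_subset_Icc_left (by linarith)
  have hsub2 : Icc (T - δ) T ⊆ Icc (T - δ₂) T := Icc_subset_Icc_left (by linarith)
  have hholder := hX.ae_holder hδ hδT hC hinc
  have hosc := GaussRep.ae_eventually_osc (θ := θ) hδ hδle3 hC' hX.alpha_pos hθ1
    fun s hs t ht => hsb s (hsub2 hs) t (hsub2 ht)
  refine ⟨fun t ω => GaussRep.strategy T δ θ (fun t => X t ω) (fun t => Z t ω) t, ?_,
    min 1 ((1 + a - θ) / 2), lt_min (by linarith) (by linarith), ?_⟩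
  · intro t
    have hm : ∀ Y : ℝ → Ω → ℝ, Adapted F (fun t : Icc (0 : ℝ) T => Y t) →
        ∀ s ∈ Icc (T - δ) (t : ℝ), Measurable[F t] (Y s) := by
      intro Y hY s hs
      have hs' : s ∈ Icc 0 T := ⟨by linarith [hs.1], hs.2.trans t.2.2⟩
      exact hY.measurable_le (i := ⟨s, hs'⟩) (j := t) hs.2
    exact @GaussRep.measurable_strategy Ω T δ θ X Z (F t) hδ t t.2.2 (hm X hXadapted)
      (hm Z hZadapted)
  · filter_upwards [hholder, hosc, hX.continuous, hZ, hZT] with ω hH ho hc hz hzT β hβ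
    have hβ1 := hβ.2.trans_le (min_le_left _ _)
    have hβ2 := hβ.2.trans_le (min_le_right _ _)
    obtain ⟨L, hL⟩ := hz
    -- The order must exceed `1 - β` for the integral to exist and `(1 + 2 * θ) / 4` for the stage
    -- gains to tend to one.
    obtain ⟨γ, hγ1, hγα⟩ : ∃ γ : ℚ, max (1 - β) ((1 + 2 * θ) / 4) < γ ∧ (γ : ℝ) < α :=
      exists_rat_btwn (max_lt (by linarith [hβ.1]) (by linarith))
    have hγβ := (le_max_left _ _).trans_lt hγ1
    have hγθ := (le_max_right _ _).trans_lt hγ1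
    obtain ⟨K, hK0, hK⟩ := hH γ (by linarith) hγα
    rw [← hzT]
    exact GaussRep.hasGLSIntegral_strategy hδ hδT hc hK0 hK (by linarith)
      (fun u hu v hv => hL u (hsub hu) v (hsub hv)) (by linarith) (by linarith [hβ.1]) hβ1 hγβ
      (by linarith) ho
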